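/- Let $s,a\in\mathbb{R}$ satisfy either ($a>\tfrac12$ and $s\le 0$) or ($s<-\tfrac14-\tfrac a2$ and $a\ge 0$). Let $H^{s,a}(\mathbb{R})$ be the space of tempered distributions $u$ whose Fourier transform $\hat u$ is a locally integrable function with $$\|u\|_{H^{s,a}}=\Big\|\big(|\xi|^a\chi_{\{|\xi|\le 1\}}+|\xi|^s\chi_{\{|\xi|>1\}}\big)\hat u(\xi)\Big\|_{L^2_\xi}<\infty,\qquad \hat u(\xi)=\frac1{\sqrt{2\pi}}\int_{\mathbb R} u(x)e^{-ix\xi}\,dx .$$ Consider the initial value problem $$iu_t+u_{xx}=u\bar u,\qquad u(x,0)=u_0(x),\qquad x\in\mathbb{R}.\tag{1}$$ For $u_0\in L^2(\mathbb R)$, an $L^2$ solution on $[0,T]$ is a $u\in C([0,T];L^2(\mathbb R))$ with $u(0)=u_0$ that satisfies (1) in the sense of distributions; it is unique if it exists. For $v\in H^{s,a}(\mathbb{R})$, an $H^{s,a}$ solution on $[0,T]$ with data $v$ is a function $w$ on $[0,T]$ with $w(0)=v$ for which there are $L^2$ solutions $u_n$ on $[0,T]$ with $\sup_{0\le t\le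 T}\|u_n(t)-w(t)\|_{H^{s,a}}\to 0$. Then (1) is not locally well-posed in $H^{s,a}(\mathbb{R})$: it is not the case that every $u_0\in H^{s,a}(\mathbb{R})$ has a ball around it in $H^{s,a}(\mathbb{R})$ and a time $T>0$ such that all data in the ball have exactly one $H^{s,a}$ solution on $[0,T]$, and this solution depends continuously, in the norm $\sup_{0\le t\le T}\|\cdot\|_{H^{s,a}}$, on the data in the $H^{s,a}$ norm. More precisely, the solution operator fails to be uniformly continuous with respect to the $H^{s,a}(\mathbb{R})$ norm: for every $T>0$ and every $R>0$, the map $u_0\mapsto u$, defined on those $u_0\in L^2(\mathbb{R})$ with $\|u_0\|_{H^{s,a}}\le R$ that have an $L^2$ solution $u$ on $[0,T]$, is not uniformly continuous from the $H^{s,a}$ norm to the norm $\sup_{0\le t\le T}\|u(t)\|_{H^{s,a}}$. -/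

import Mathlib

open MeasureTheory Filter Set
open scoped ENNReal SchwartzMap FourierTransform Topology ComplexConjugate

noncomputable section

/-- The space `L²(ℝ; ℂ)`. -/
abbrev L2 : Type := Lp ℂ 2 (volume : Measure ℝ)

/-- The weight `|ξ|^a` for `|ξ| ≤ 1` and `|ξ|^s` for `|ξ| > 1`. -/
def hsaWeight (s a ξ : ℝ) : ℝ :=
  if |ξ| ≤ 1 then |ξ| ^ a else |ξ| ^ s

/-- The norm of `H^{s,a}(ℝ)`, as an extended real: for a tempered distribution `u` whose Fourier
transform is a locally integrable function `g` (unique up to null sets) it is the `L²` norm of the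
weighted Fourier transform, and it is `∞` if the Fourier transform is not such a function.

Mathlib's transform is `𝓕 u (ξ) = ∫ u(x) e^{-2πixξ} dx`; evaluating the weight at `2πξ` gives exactly
the norm formed with the unitary transform `û(ξ) = (2π)^{-1/2} ∫ u(x) e^{-ixξ} dx`. -/
def hsaNorm (s a : ℝ) (u : 𝓢'(ℝ, ℂ)) : ℝ≥0∞ :=
  ⨅ (g : ℝ → ℂ) (_ : LocallyIntegrable g volume ∧ ∀ φ : 𝓢(ℝ, ℂ), (𝓕 u) φ = ∫ ξ, φ ξ * g ξ),
    eLpNorm (fun ξ => (hsaWeight s a (2 * Real.pi * ξ) : ℂ) * g ξ) 2 volume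

/-- `u` is an `L²` solution on `[0, T]` of `i u_t + u_xx = u ū`, `u(0) = u₀`: it lies in
`C([0, T]; L²(ℝ))`, takes the value `u₀` at time `0`, and satisfies the equation in the sense of
distributions in `x`, integrated in time. (Every term is finite, as `u ū` is in `C([0, T]; L¹)`.
For given data `u₀ ∈ L²` there is at most one such `u` on `[0, T]`.) -/
structure IsL2Solution (T : ℝ) (u₀ : L2) (u : ℝ → L2) : Prop where
  continuousOn : ContinuousOn u (Icc 0 T)
  initial : u 0 = u₀
  equation : ∀ t ∈ Icc 0 T, ∀ φ : 𝓢(ℝ, ℂ),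
    Complex.I * ((∫ x, u t x * φ x) - ∫ x, u₀ x * φ x)
        + ∫ τ in (0 : ℝ)..t, ∫ x, u τ x * deriv (deriv φ) x
      = ∫ τ in (0 : ℝ)..t, ∫ x, (u τ x * conj (u τ x)) * φ x

/-- `w` is a solution on `[0, T]` with data `v` in the space `H^{s,a}`, where the product `u ū` need
not make sense directly: `w(0) = v`, and `w` is a limit of `L²` solutions on `[0, T]`, in the
`H^{s,a}` norm and uniformly in time. Every `L²` solution is one (constant sequence). -/
def IsHsaSolution (s a T : ℝ) (v : 𝓢'(ℝ, ℂ)) (w : ℝ → 𝓢'(ℝ, ℂ)) : Prop :=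
  w 0 = v ∧ ∃ (v' : ℕ → L2) (u : ℕ → ℝ → L2),
    (∀ n, IsL2Solution T (v' n) (u n)) ∧
    Tendsto (fun n => ⨆ t ∈ Icc 0 T, hsaNorm s a ((u n t : 𝓢'(ℝ, ℂ)) - w t)) atTop (𝓝 0)

/-- Local well-posedness of `i u_t + u_xx = u ū` in `H^{s,a}`, in the sense of Hadamard: around every
`u₀ ∈ H^{s,a}` there are a ball and a time `T > 0` such that all data in the ball have exactly one
solution on `[0, T]`, which depends continuously on the data (from the `H^{s,a}` norm to the norm of
`C([0, T]; H^{s,a})`). -/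
def LocallyWellPosed (s a : ℝ) : Prop :=
  ∀ u₀ : 𝓢'(ℝ, ℂ), hsaNorm s a u₀ < ∞ → ∃ r : ℝ≥0∞, 0 < r ∧ ∃ T : ℝ, 0 < T ∧
    -- existence
    (∀ v : 𝓢'(ℝ, ℂ), hsaNorm s a (v - u₀) < r → ∃ w, IsHsaSolution s a T v w) ∧
    -- uniqueness
    (∀ v : 𝓢'(ℝ, ℂ), hsaNorm s a (v - u₀) < r → ∀ w₁ w₂,
      IsHsaSolution s a T v w₁ → IsHsaSolution s a T v w₂ → EqOn w₁ w₂ (Icc 0 T)) ∧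
    -- continuous dependence
    (∀ v : 𝓢'(ℝ, ℂ), hsaNorm s a (v - u₀) < r → ∀ w, IsHsaSolution s a T v w →
      ∀ ε : ℝ≥0∞, 0 < ε → ∃ δ : ℝ≥0∞, 0 < δ ∧
        ∀ v' : 𝓢'(ℝ, ℂ), hsaNorm s a (v' - u₀) < r → hsaNorm s a (v' - v) < δ →
          ∀ w', IsHsaSolution s a T v' w' → ∀ t ∈ Icc 0 T, hsaNorm s a (w' t - w t) ≤ ε)

/-- The solution operator `u₀ ↦ u` of `i u_t + u_xx = u ū` on `[0, T]`, restricted to those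
`u₀ ∈ L²` that have an `L²` solution on `[0, T]` and satisfy `‖u₀‖_{H^{s,a}} ≤ R`, is uniformly
continuous from the `H^{s,a}` norm to the norm of `C([0, T]; H^{s,a})`. -/
def SolutionOperatorUniformlyContinuous (s a T : ℝ) (R : ℝ≥0∞) : Prop :=
  ∀ ε : ℝ≥0∞, 0 < ε → ∃ δ : ℝ≥0∞, 0 < δ ∧
    ∀ (u₀ v₀ : L2) (u v : ℝ → L2), IsL2Solution T u₀ u → IsL2Solution T v₀ v →
      hsaNorm s a u₀ ≤ R → hsaNorm s a v₀ ≤ R →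
      hsaNorm s a ((u₀ : 𝓢'(ℝ, ℂ)) - v₀) ≤ δ →
      ∀ t ∈ Icc 0 T, hsaNorm s a ((u t : 𝓢'(ℝ, ℂ)) - v t) ≤ ε

end

noncomputable section

/-! The mechanism is norm inflation through the quadratic term: data that are tiny in `H^{s,a}` but
whose Fourier transforms have a fixed small `L¹` mass produce, at first order in Duhamel's formula,
an output of fixed size.

Solutions are built on the Fourier side in the interaction picture, `F(t) = f - i ∫₀ᵗ interaction`.
If `M ≥ |f| + A (M ⋆ M)` and `8T ≤ A`, Picard iteration stays below `2M` and converges on all of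
`[0, T]` (`IsMajorant.exists_isProfile`). Such an `M` exists once `4A ‖f‖₁ ≤ 1`
(`exists_isMajorant`), a condition on the `L¹` mass alone, so heights and frequencies in the data
remain free. `IsProfile.isL2Solution` returns to physical space, and `IsProfile.norm_sub_duhamel_le`
bounds everything beyond the first Duhamel term by `16 t² / A` times `M ⋆ M`. For nonnegative data
the phase in the first term is `8π²τξ(ξ - η)`; where it is at most `1` in size there is no
cancellation and the term is at least `t/2` times the autocorrelation of `f`
(`IsProfile.le_norm_of_phase_le`). Large `A` makes the remainder harmless.

Two choices of data cover the parameters. For `a > 1/2`, add to a fixed box on `[1, 2]` a box of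
mass `c` on `[0, d]`: its norm is `O(d^(a - 1/2))`, yet it moves the fixed box to frequencies near
`-3/2`. For `0 ≤ a ≤ 1/2`, compare the zero solution with a box of mass `c` and width `N^(-a - 1/2)`
at frequency `N`: its norm is `O(N^(s + a/2 + 1/4))`, and its self-interaction has norm bounded
below at frequencies of order `1/N`. Either way the solution map is discontinuous at a datum that
can be taken in any ball about `0`, which refutes both well-posedness and uniform continuity. -/

/-! ### The norm and `L²` data on the Fourier side -/

theorem hsaNorm_eq_eLpNorm {s a : ℝ} {u : 𝓢'(ℝ, ℂ)} {U : ℝ → ℂ} (hU : LocallyIntegrable U volume)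
    (h : ∀ φ : 𝓢(ℝ, ℂ), (𝓕 u) φ = ∫ ξ, φ ξ * U ξ) :
    hsaNorm s a u = eLpNorm (fun ξ => (hsaWeight s a (2 * Real.pi * ξ) : ℂ) * U ξ) 2 volume := by
  refine le_antisymm (iInf₂_le U ⟨hU, h⟩) (le_iInf₂ fun g hg => le_of_eq ?_)
  -- All competitors in the infimum represent the same distribution, so they agree almost
  -- everywhere; real bump functions suffice as tests.
  have hae : ∀ᵐ x ∂(volume : Measure ℝ), U x = g x := by
    refine ae_eq_of_integral_contDiff_smul_eq hU hg.1 fun ψ hψ hc => ?_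
    have hc' : HasCompactSupport (Complex.ofRealCLM ∘ ψ) := hc.comp_left rfl
    have hψ' : ContDiff ℝ ((⊤ : ℕ∞) : WithTop ℕ∞) (Complex.ofRealCLM ∘ ψ) :=
      Complex.ofRealCLM.contDiff.comp hψ
    have h1 := h (hc'.toSchwartzMap hψ')
    rw [hg.2 (hc'.toSchwartzMap hψ')] at h1
    simpa using h1.symm
  refine eLpNorm_congr_ae ?_
  filter_upwards [hae] with x hx
  rw [hx]

/-- The `L²` function with Fourier transform `U`. -/
def invFourier (U : ℝ → ℂ) (hU : MemLp U 2 volume) : L2 := 𝓕⁻ (hU.toLp U)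

theorem fourier_invFourier_apply {U : ℝ → ℂ} (hU : MemLp U 2 volume) (φ : 𝓢(ℝ, ℂ)) :
    (𝓕 (invFourier U hU : 𝓢'(ℝ, ℂ))) φ = ∫ ξ, φ ξ * U ξ := by
  rw [Lp.fourier_toTemperedDistribution_eq, invFourier, FourierTransform.fourier_fourierInv_eq,
    Lp.toTemperedDistribution_apply]
  refine integral_congr_ae ?_
  filter_upwards [hU.coeFn_toLp] with x hx
  rw [hx, smul_eq_mul]

theorem hsaNorm_invFourier (s a : ℝ) {U : ℝ → ℂ} (hU : MemLp U 2 volume) :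
    hsaNorm s a (invFourier U hU) =
      eLpNorm (fun ξ => (hsaWeight s a (2 * Real.pi * ξ) : ℂ) * U ξ) 2 volume :=
  hsaNorm_eq_eLpNorm (hU.locallyIntegrable (by norm_num)) (fourier_invFourier_apply hU)

theorem invFourier_sub {U V : ℝ → ℂ} (hU : MemLp U 2 volume) (hV : MemLp V 2 volume) :
    invFourier U hU - invFourier V hV = invFourier (U - V) (hU.sub hV) := by
  simp only [invFourier]
  exact ((Lp.fourierTransformₗᵢ ℝ ℂ).symm.map_sub _ _).symm

theorem toTemperedDistribution_sub (u v : L2) :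
    Lp.toTemperedDistribution u - Lp.toTemperedDistribution v = Lp.toTemperedDistribution (u - v) :=
  ((Lp.toTemperedDistributionCLM ℂ volume 2).map_sub u v).symm

theorem hsaNorm_invFourier_sub (s a : ℝ) {U V : ℝ → ℂ} (hU : MemLp U 2 volume)
    (hV : MemLp V 2 volume) :
    hsaNorm s a ((invFourier U hU : 𝓢'(ℝ, ℂ)) - (invFourier V hV : 𝓢'(ℝ, ℂ))) =
      eLpNorm (fun ξ => (hsaWeight s a (2 * Real.pi * ξ) : ℂ) * (U ξ - V ξ)) 2 volume := by
  rw [toTemperedDistribution_sub, invFourier_sub, hsaNorm_invFourier]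
  rfl

/-! ### The terms of the weak equation on the Fourier side -/

theorem integral_invFourier_mul {U : ℝ → ℂ} (hU : MemLp U 2 volume) (φ : 𝓢(ℝ, ℂ)) :
    ∫ x, invFourier U hU x * φ x = ∫ ξ, U ξ * (𝓕⁻ φ) ξ := by
  have h := fourier_invFourier_apply hU (𝓕⁻ φ)
  rw [TemperedDistribution.fourier_apply, FourierTransform.fourier_fourierInv_eq,
    Lp.toTemperedDistribution_apply] at h
  simp only [smul_eq_mul] at h
  simpa only [mul_comm] using h

theorem integral_fourierInv_mul_eq {U V : ℝ → ℂ} (hU : Integrable U) (hV : Integrable V) :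
    ∫ x, 𝓕⁻ U x * V x = ∫ ξ, U ξ * 𝓕⁻ V ξ := by
  have h := VectorFourier.integral_fourierIntegral_smul_eq_flip (μ := volume) (ν := volume)
    (L := -innerₗ ℝ) (f := U) (g := V) Real.continuous_fourierChar
    (by simpa using (by fun_prop : Continuous fun p : ℝ × ℝ => -(p.2 * p.1))) hU hV
  have hf : (-innerₗ ℝ : ℝ →ₗ[ℝ] ℝ →ₗ[ℝ] ℝ).flip = -innerₗ ℝ := by
    ext; simp
  rw [hf] at h
  exact h

theorem integral_fourier_mul_eq {U V : ℝ → ℂ} (hU : Integrable U) (hV : Integrable V) :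
    ∫ x, 𝓕 U x * V x = ∫ ξ, U ξ * 𝓕 V ξ := by
  have h := VectorFourier.integral_fourierIntegral_smul_eq_flip (μ := volume) (ν := volume)
    (L := innerₗ ℝ) (f := U) (g := V) Real.continuous_fourierChar
    continuous_inner hU hV
  rwa [flip_innerₗ] at h

theorem coeFn_invFourier {U : ℝ → ℂ} (hU : MemLp U 2 volume) (hU1 : Integrable U) :
    invFourier U hU =ᵐ[volume] 𝓕⁻ U := by
  have hcont : Continuous (𝓕⁻ U) :=
    VectorFourier.fourierIntegral_continuous Real.continuous_fourierChar
      (by simpa using (by fun_prop : Continuous fun p : ℝ × ℝ => -(p.2 * p.1))) hU1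
  refine ae_eq_of_integral_contDiff_smul_eq
    ((Lp.memLp (invFourier U hU)).locallyIntegrable (by norm_num)) hcont.locallyIntegrable
    fun ψ hψ hc => ?_
  have hc' : HasCompactSupport (Complex.ofRealCLM ∘ ψ) := hc.comp_left rfl
  have hψ' : ContDiff ℝ ((⊤ : ℕ∞) : WithTop ℕ∞) (Complex.ofRealCLM ∘ ψ) :=
    Complex.ofRealCLM.contDiff.comp hψ
  set φ := hc'.toSchwartzMap hψ'
  have h1 := integral_invFourier_mul hU φ
  have h2 := integral_fourierInv_mul_eq hU1 φ.integrable
  rw [← SchwartzMap.fourierInv_coe, ← h1] at h2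
  simpa [φ, mul_comm] using h2.symm

theorem fourierInv_deriv_deriv (φ : 𝓢(ℝ, ℂ)) (ξ : ℝ) :
    𝓕⁻ (fun x => deriv (deriv φ) x) ξ = -(4 * Real.pi ^ 2 * ξ ^ 2 : ℝ) * (𝓕⁻ φ) ξ := by
  have e1 : deriv φ = ((SchwartzMap.derivCLM ℂ ℂ φ : 𝓢(ℝ, ℂ)) : ℝ → ℂ) := rfl
  have e2 : (fun x => deriv (deriv φ) x) = ((SchwartzMap.derivCLM ℂ ℂ
      (SchwartzMap.derivCLM ℂ ℂ φ) : 𝓢(ℝ, ℂ)) : ℝ → ℂ) := rfl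
  rw [SchwartzMap.fourierInv_coe, Real.fourierInv_eq_fourier_neg, Real.fourierInv_eq_fourier_neg]
  change 𝓕 (deriv (deriv φ)) (-ξ) = _
  rw [Real.fourier_deriv, Real.fourier_deriv]
  · simp only [smul_eq_mul]
    push_cast
    ring_nf
    simp only [Complex.I_sq]
    ring
  · exact φ.integrable
  · exact φ.differentiable
  · exact e1 ▸ SchwartzMap.integrable _
  · exact e1 ▸ SchwartzMap.integrable _
  · exact e1 ▸ SchwartzMap.differentiable _
  · change Integrable (fun x => deriv (deriv φ) x)
    exact e2 ▸ SchwartzMap.integrable _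

theorem integral_invFourier_mul_deriv_deriv {U : ℝ → ℂ} (hU : MemLp U 2 volume) (φ : 𝓢(ℝ, ℂ)) :
    ∫ x, invFourier U hU x * deriv (deriv φ) x =
      ∫ ξ, U ξ * (-(4 * Real.pi ^ 2 * ξ ^ 2 : ℝ) * (𝓕⁻ φ) ξ) := by
  have h := integral_invFourier_mul hU (SchwartzMap.derivCLM ℂ ℂ (SchwartzMap.derivCLM ℂ ℂ φ))
  simp_rw [← fourierInv_deriv_deriv]
  rw [SchwartzMap.fourierInv_coe] at h
  exact h

theorem fourierInv_mul_fourier_modulation {U : ℝ → ℂ} (hU : Integrable U) (φ : 𝓢(ℝ, ℂ)) (ζ : ℝ) :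
    𝓕 (fun x => 𝓕⁻ U x * φ x) ζ = ∫ ξ, U (ξ + ζ) * (𝓕⁻ φ) ξ := by
  have hint : Integrable fun x => ((Real.fourierChar (-(x * ζ)) : Circle) : ℂ) * φ x := by
    refine φ.integrable.bdd_mul (c := 1) ?_ ?_
    · exact (by fun_prop : Continuous _).aestronglyMeasurable
    · exact .of_forall fun x => (Circle.norm_coe _).le
  rw [Real.fourier_real_eq]
  calc _ = ∫ x, 𝓕⁻ U x * (((Real.fourierChar (-(x * ζ)) : Circle) : ℂ) * φ x) := by
        refine integral_congr_ae (.of_forall fun x => ?_)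
        simp only [Circle.smul_def, smul_eq_mul]
        ring
    _ = _ := by
        rw [integral_fourierInv_mul_eq hU hint, ← integral_add_right_eq_self _ ζ]
        refine integral_congr_ae (.of_forall fun ξ => ?_)
        simp only
        congr 1
        rw [SchwartzMap.fourierInv_coe, Real.fourierInv_eq, Real.fourierInv_eq]
        refine integral_congr_ae (.of_forall fun x => ?_)
        simp only [Circle.smul_def, smul_eq_mul]
        rw [← mul_assoc, ← Circle.coe_mul, ← AddChar.map_add_eq_mul]
        congr 3
        simp
        ring

theorem conj_fourierInv (U : ℝ → ℂ) (x : ℝ) :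
    conj (𝓕⁻ U x) = 𝓕 (fun ξ => conj (U ξ)) x := by
  rw [Real.fourierInv_eq, Real.fourier_eq, ← integral_conj]
  refine integral_congr_ae (.of_forall fun ξ => ?_)
  simp [Circle.smul_def, AddChar.map_neg_eq_inv]

/-- The convolution theorem for `|u|²`, paired with a test function. Integrability of `U` makes `u`
a bounded continuous function; the bound `S` makes the double integral absolutely convergent. -/
theorem integral_invFourier_mul_conj_mul {U : ℝ → ℂ} (hU : MemLp U 2 volume)
    (hU1 : Integrable U) {S : ℝ} (hS : ∀ ξ, ‖U ξ‖ ≤ S) (φ : 𝓢(ℝ, ℂ)) :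
    ∫ x, (invFourier U hU x * conj (invFourier U hU x)) * φ x =
      ∫ ξ, (∫ η, U η * conj (U (η - ξ))) * (𝓕⁻ φ) ξ := by
  have hcont : Continuous (𝓕⁻ U) :=
    VectorFourier.fourierIntegral_continuous Real.continuous_fourierChar
      (by simpa using (by fun_prop : Continuous fun p : ℝ × ℝ => -(p.2 * p.1))) hU1
  have hconj : Integrable fun ξ => conj (U ξ) :=
    (Complex.conjLIE.toContinuousLinearEquiv.toContinuousLinearMap.integrable_comp hU1)
  have huφ : Integrable fun x => 𝓕⁻ U x * φ x := by
    refine φ.integrable.bdd_mul (c := ∫ ξ, ‖U ξ‖) hcont.aestronglyMeasurable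
      (.of_forall fun x => ?_)
    exact VectorFourier.norm_fourierIntegral_le_integral_norm _ _ _ _ _
  calc _ = ∫ x, 𝓕 (fun ξ => conj (U ξ)) x * (𝓕⁻ U x * φ x) := by
        refine integral_congr_ae ?_
        filter_upwards [coeFn_invFourier hU hU1] with x hx
        rw [hx, conj_fourierInv]
        ring
    _ = ∫ ζ, conj (U ζ) * ∫ ξ, U (ξ + ζ) * (𝓕⁻ φ) ξ := by
        rw [integral_fourier_mul_eq hconj huφ]
        simp_rw [fourierInv_mul_fourier_modulation hU1]
    _ = ∫ ζ, ∫ ξ, conj (U ζ) * (U (ξ + ζ) * (𝓕⁻ φ) ξ) := by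
        simp_rw [integral_const_mul]
    _ = ∫ ξ, ∫ ζ, conj (U ζ) * (U (ξ + ζ) * (𝓕⁻ φ) ξ) := by
        refine integral_integral_swap ?_
        have hm : AEStronglyMeasurable (fun p : ℝ × ℝ => U (p.2 + p.1)) (volume.prod volume) := by
          have := hU1.aestronglyMeasurable.comp_quasiMeasurePreserving
            (quasiMeasurePreserving_add_swap (volume : Measure ℝ) volume)
          exact this
        have hb : Integrable (fun p : ℝ × ℝ => conj (U p.1) * (𝓕⁻ φ) p.2)
            (volume.prod volume) := hconj.mul_prod (SchwartzMap.integrable _)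
        refine (hb.bdd_mul (c := S) hm (.of_forall fun p => hS _)).congr (.of_forall fun p => ?_)
        simp only [Function.uncurry]
        ring
    _ = _ := by
        refine integral_congr_ae (.of_forall fun ξ => ?_)
        simp only
        rw [← integral_mul_const, ← integral_sub_right_eq_self _ ξ]
        refine integral_congr_ae (.of_forall fun η => ?_)
        simp only [add_sub_cancel]
        ring

/-! ### Majorants for the quadratic iteration -/

/-- The iterates `m ↦ f + A (m ⋆ m)` from `0`, where `(m ⋆ m)(ξ) = ∫ m(η) m(η - ξ) dη`. -/
def majorantIter (f : ℝ → ℝ≥0∞) (A : ℝ≥0∞) : ℕ → ℝ → ℝ≥0∞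
  | 0 => fun _ => 0
  | n + 1 => fun ξ => f ξ + A * ∫⁻ η, majorantIter f A n η * majorantIter f A n (η - ξ)

theorem measurable_lcorr {m : ℝ → ℝ≥0∞} (hm : Measurable m) :
    Measurable fun ξ => ∫⁻ η, m η * m (η - ξ) :=
  Measurable.lintegral_prod_right' (f := fun p : ℝ × ℝ => m p.2 * m (p.2 - p.1)) (by fun_prop)

theorem lintegral_lcorr {m : ℝ → ℝ≥0∞} (hm : Measurable m) :
    ∫⁻ ξ, ∫⁻ η, m η * m (η - ξ) = (∫⁻ η, m η) * ∫⁻ η, m η := by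
  rw [lintegral_lintegral_swap (by fun_prop)]
  have h (η : ℝ) : ∫⁻ ξ, m η * m (η - ξ) = m η * ∫⁻ ξ, m ξ := by
    rw [lintegral_const_mul _ (by fun_prop), lintegral_sub_left_eq_self m η]
  simp_rw [h]
  rw [lintegral_mul_const _ hm]

theorem measurable_majorantIter {f : ℝ → ℝ≥0∞} (hf : Measurable f) (A : ℝ≥0∞) (n : ℕ) :
    Measurable (majorantIter f A n) := by
  induction n with
  | zero => exact measurable_const
  | succ n ih => exact hf.add ((measurable_lcorr ih).const_mul A)

theorem majorantIter_le_succ (f : ℝ → ℝ≥0∞) (A : ℝ≥0∞) (n : ℕ) (ξ : ℝ) :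
    majorantIter f A n ξ ≤ majorantIter f A (n + 1) ξ := by
  induction n generalizing ξ with
  | zero => exact zero_le
  | succ n ih =>
    change _ + _ ≤ _ + _
    gcongr with η
    · exact ih η
    · exact ih _

/-- The autocorrelation squares the mass, so the induction closes because `l + A (2l)² ≤ 2l`, which
is the condition `4Al ≤ 1`. -/
theorem lintegral_majorantIter_le {f : ℝ → ℝ≥0∞} (hf : Measurable f) {A l : ℝ≥0∞}
    (hl : ∫⁻ ξ, f ξ ≤ l) (hA : 4 * A * l ≤ 1) (n : ℕ) :
    ∫⁻ ξ, majorantIter f A n ξ ≤ 2 * l := by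
  induction n with
  | zero => simp [majorantIter]
  | succ n ih =>
    have hm := measurable_majorantIter hf A n
    simp only [majorantIter]
    rw [lintegral_add_left hf, lintegral_const_mul _ (measurable_lcorr hm), lintegral_lcorr hm]
    calc _ ≤ l + A * (2 * l * (2 * l)) := by gcongr
      _ = l + (4 * A * l) * l := by ring
      _ ≤ l + 1 * l := by gcongr
      _ = 2 * l := by ring

/-- One factor of the autocorrelation is taken in `L¹` and the other in sup norm, so the same mass
condition closes the bound and `S` may be arbitrarily large. -/
theorem majorantIter_le {f : ℝ → ℝ≥0∞} (hf : Measurable f) {A l S : ℝ≥0∞}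
    (hl : ∫⁻ ξ, f ξ ≤ l) (hA : 4 * A * l ≤ 1) (hS : ∀ ξ, f ξ ≤ S) (n : ℕ) (ξ : ℝ) :
    majorantIter f A n ξ ≤ 2 * S := by
  induction n generalizing ξ with
  | zero => exact zero_le
  | succ n ih =>
    have hm := measurable_majorantIter hf A n
    calc _ ≤ S + A * ∫⁻ η, majorantIter f A n η * (2 * S) := by
          change _ + _ ≤ _
          gcongr with η
          · exact hS ξ
          · exact ih _
      _ = S + A * ((∫⁻ η, majorantIter f A n η) * (2 * S)) := by
          rw [lintegral_mul_const _ hm]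
      _ ≤ S + A * (2 * l * (2 * S)) := by
          gcongr
          exact lintegral_majorantIter_le hf hl hA n
      _ = S + (4 * A * l) * S := by ring
      _ ≤ S + 1 * S := by gcongr
      _ = 2 * S := by ring

theorem exists_lmajorant {f : ℝ → ℝ≥0∞} (hf : Measurable f) {A l S : ℝ≥0∞}
    (hl : ∫⁻ ξ, f ξ ≤ l) (hA : 4 * A * l ≤ 1) (hS : ∀ ξ, f ξ ≤ S) :
    ∃ m : ℝ → ℝ≥0∞, Measurable m ∧ (∀ ξ, f ξ + A * ∫⁻ η, m η * m (η - ξ) ≤ m ξ) ∧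
      ∫⁻ ξ, m ξ ≤ 2 * l ∧ ∀ ξ, m ξ ≤ 2 * S := by
  have hmono (ξ : ℝ) : Monotone fun n => majorantIter f A n ξ :=
    monotone_nat_of_le_succ fun n => majorantIter_le_succ f A n ξ
  have hmeas := measurable_majorantIter hf A
  refine ⟨fun ξ => ⨆ n, majorantIter f A n ξ, .iSup hmeas, fun ξ => ?_, ?_, fun ξ => ?_⟩
  -- For increasing sequences the product of suprema is attained along the diagonal; monotone
  -- convergence then passes the recursion to the limit.
  · have h (η : ℝ) : (⨆ n, majorantIter f A n η) * (⨆ n, majorantIter f A n (η - ξ)) =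
        ⨆ n, majorantIter f A n η * majorantIter f A n (η - ξ) :=
      le_antisymm
        (by
          simp_rw [ENNReal.iSup_mul, ENNReal.mul_iSup]
          exact iSup₂_le fun i j => le_iSup_of_le (max i j)
            (mul_le_mul' (hmono η (le_max_left i j)) (hmono _ (le_max_right i j))))
        ENNReal.iSup_mul_le
    simp_rw [h]
    rw [lintegral_iSup (f := fun n η => majorantIter f A n η * majorantIter f A n (η - ξ))
      (fun n => by have := hmeas n; fun_prop)
      (fun i j hij η => mul_le_mul' (hmono η hij) (hmono _ hij)), ENNReal.mul_iSup,
      ENNReal.add_iSup]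
    exact iSup_le fun n => le_iSup_of_le (n + 1) le_rfl
  · rw [lintegral_iSup hmeas fun i j hij ξ => hmono ξ hij]
    exact iSup_le (lintegral_majorantIter_le hf hl hA)
  · exact iSup_le fun n => majorantIter_le hf hl hA hS n ξ

/-- The autocorrelation `∫ m(η) m(η - ξ) dη`. -/
def autocorr (m : ℝ → ℝ) (ξ : ℝ) : ℝ := ∫ η, m η * m (η - ξ)

/-- A bounded integrable function `M ≥ |f| + A (M ⋆ M)`, with `L¹` and sup norm at most `2l`, `2S`. -/
structure IsMajorant (A l S : ℝ) (f : ℝ → ℂ) (M : ℝ → ℝ) : Prop where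
  measurable : Measurable M
  le : ∀ ξ, ‖f ξ‖ + A * autocorr M ξ ≤ M ξ
  nonneg : ∀ ξ, 0 ≤ M ξ
  integrable : Integrable M
  integral_le : ∫ ξ, M ξ ≤ 2 * l
  le_bound : ∀ ξ, M ξ ≤ 2 * S

theorem exists_isMajorant {f : ℝ → ℂ} (hf : Measurable f) (hfi : Integrable f) {A l S : ℝ}
    (hA0 : 0 ≤ A) (hl : ∫ ξ, ‖f ξ‖ ≤ l) (hA : 4 * A * l ≤ 1) (hS : ∀ ξ, ‖f ξ‖ ≤ S) :
    ∃ M, IsMajorant A l S f M := by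
  have hl0 : 0 ≤ l := (integral_nonneg fun _ => norm_nonneg _).trans hl
  have hS0 : 0 ≤ S := (norm_nonneg _).trans (hS 0)
  obtain ⟨m, hm, hle, hint, hb⟩ := exists_lmajorant (f := fun ξ => ‖f ξ‖ₑ)
    (A := ENNReal.ofReal A) (l := ENNReal.ofReal l) (S := ENNReal.ofReal S) (by fun_prop)
    (by rw [← ofReal_integral_norm_eq_lintegral_enorm hfi]; exact ENNReal.ofReal_le_ofReal hl)
    (by
      rw [show (4 : ℝ≥0∞) = ENNReal.ofReal 4 by simp, ← ENNReal.ofReal_mul (by norm_num),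
        ← ENNReal.ofReal_mul (by positivity)]
      exact ENNReal.ofReal_le_one.2 hA)
    (fun ξ => by rw [← ofReal_norm]; exact ENNReal.ofReal_le_ofReal (hS ξ))
  have htwo (r : ℝ) : 2 * ENNReal.ofReal r = ENNReal.ofReal (2 * r) := by
    rw [ENNReal.ofReal_mul (by norm_num)]; simp
  rw [htwo] at hint
  simp_rw [htwo] at hb
  have hfin (ξ : ℝ) : m ξ ≠ ∞ := ((hb ξ).trans_lt ENNReal.ofReal_lt_top).ne
  have hcorr (ξ : ℝ) : autocorr (fun ξ => (m ξ).toReal) ξ = (∫⁻ η, m η * m (η - ξ)).toReal := by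
    simp_rw [autocorr, ← ENNReal.toReal_mul]
    exact integral_toReal (by fun_prop)
      (.of_forall fun η => ENNReal.mul_lt_top (hfin _).lt_top (hfin _).lt_top)
  refine ⟨fun ξ => (m ξ).toReal, hm.ennreal_toReal, fun ξ => ?_, fun _ => ENNReal.toReal_nonneg,
    integrable_toReal_of_lintegral_ne_top hm.aemeasurable
      (hint.trans_lt ENNReal.ofReal_lt_top).ne, ?_, fun ξ => ?_⟩
  · have h := ENNReal.toReal_mono (hfin ξ) (hle ξ)
    have hne := ((hle ξ).trans_lt (hfin ξ).lt_top).ne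
    rw [ENNReal.toReal_add (ENNReal.add_ne_top.1 hne).1 (ENNReal.add_ne_top.1 hne).2,
      ENNReal.toReal_mul, ENNReal.toReal_ofReal hA0, toReal_enorm] at h
    rw [hcorr]
    exact h
  · rw [integral_toReal hm.aemeasurable (.of_forall fun η => (hfin _).lt_top)]
    exact ENNReal.toReal_le_of_le_ofReal (by positivity) hint
  · exact ENNReal.toReal_le_of_le_ofReal (by positivity) (hb ξ)

namespace IsMajorant

variable {A l S : ℝ} {f : ℝ → ℂ} {M : ℝ → ℝ}

theorem integrable_mul_sub (h : IsMajorant A l S f M) (ξ : ℝ) :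
    Integrable fun η => M η * M (η - ξ) := by
  have hm := h.measurable
  refine (h.integrable.bdd_mul (c := 2 * S) (f := fun η => M (η - ξ))
    (by fun_prop : Measurable _).aestronglyMeasurable (.of_forall fun η => ?_)).congr
    (.of_forall fun η => mul_comm _ _)
  rw [Real.norm_of_nonneg (h.nonneg _)]
  exact h.le_bound _

theorem autocorr_nonneg (h : IsMajorant A l S f M) (ξ : ℝ) : 0 ≤ autocorr M ξ :=
  integral_nonneg fun _ => mul_nonneg (h.nonneg _) (h.nonneg _)

theorem bound_nonneg (h : IsMajorant A l S f M) : 0 ≤ 2 * S := (h.nonneg 0).trans (h.le_bound 0)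

theorem mass_nonneg (h : IsMajorant A l S f M) : 0 ≤ 2 * l :=
  (integral_nonneg h.nonneg).trans h.integral_le

theorem autocorr_le (h : IsMajorant A l S f M) (ξ : ℝ) : autocorr M ξ ≤ 4 * l * S := by
  calc autocorr M ξ ≤ ∫ η, M η * (2 * S) := by
        refine integral_mono (h.integrable_mul_sub ξ) (h.integrable.mul_const _) fun η => ?_
        exact mul_le_mul_of_nonneg_left (h.le_bound _) (h.nonneg _)
    _ = (∫ η, M η) * (2 * S) := integral_mul_const _ _
    _ ≤ 2 * l * (2 * S) := mul_le_mul_of_nonneg_right h.integral_le h.bound_nonneg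
    _ = 4 * l * S := by ring

theorem norm_le (h : IsMajorant A l S f M) (hA : 0 ≤ A) (ξ : ℝ) : ‖f ξ‖ ≤ M ξ :=
  (le_add_of_nonneg_right (mul_nonneg hA (h.autocorr_nonneg ξ))).trans (h.le ξ)

theorem mul_autocorr_le (h : IsMajorant A l S f M) (ξ : ℝ) : A * autocorr M ξ ≤ M ξ :=
  (le_add_of_nonneg_left (norm_nonneg _)).trans (h.le ξ)

theorem integrable_prod (h : IsMajorant A l S f M) :
    Integrable (fun p : ℝ × ℝ => M p.2 * M (p.2 - p.1)) (volume.prod volume) := by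
  have := h.integrable.convolution_integrand (ContinuousLinearMap.mul ℝ ℝ) h.integrable.comp_neg
  simpa using this

theorem integrable_autocorr (h : IsMajorant A l S f M) : Integrable (autocorr M) :=
  h.integrable_prod.integral_prod_left

theorem integral_autocorr_le (h : IsMajorant A l S f M) : ∫ ξ, autocorr M ξ ≤ 4 * l ^ 2 := by
  have h1 : ∫ ξ, autocorr M ξ = (∫ ξ, M ξ) * ∫ ξ, M ξ := by
    unfold autocorr
    rw [integral_integral_swap h.integrable_prod]
    simp_rw [integral_const_mul, integral_sub_left_eq_self M]
    rw [integral_mul_const]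
  rw [h1]
  nlinarith [h.integral_le, h.mass_nonneg, integral_nonneg (μ := volume) (f := M) h.nonneg]

end IsMajorant

/-! ### The interaction picture -/

/-- The symbol `e^{-4π²itξ²}` of the free Schrödinger group. -/
def schr (t ξ : ℝ) : ℂ := Complex.exp ((-(4 * Real.pi ^ 2 * t * ξ ^ 2) : ℝ) * Complex.I)

@[fun_prop]
theorem continuous_schr : Continuous fun p : ℝ × ℝ => schr p.1 p.2 := by
  unfold schr; fun_prop

@[simp]
theorem norm_schr (t ξ : ℝ) : ‖schr t ξ‖ = 1 := Complex.norm_exp_ofReal_mul_I _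

theorem schr_mul_conj (t ξ : ℝ) : schr t ξ * conj (schr t ξ) = 1 := by
  rw [Complex.mul_conj, Complex.normSq_eq_norm_sq]; simp

@[simp]
theorem schr_zero (ξ : ℝ) : schr 0 ξ = 1 := by simp [schr]

/-- The Fourier transform of `|u|²`, where `G` is that of `u`. -/
def quad (G : ℝ → ℂ) (ξ : ℝ) : ℂ := ∫ η, G η * conj (G (η - ξ))

/-- The quadratic nonlinearity in the interaction picture at time `τ`, on the Fourier side. -/
def interaction (τ : ℝ) (G : ℝ → ℂ) (ξ : ℝ) : ℂ :=
  conj (schr τ ξ) * quad (fun η => schr τ η * G η) ξ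

theorem measurable_interaction {F : ℝ → ℝ → ℂ} (hF : Measurable fun p : ℝ × ℝ => F p.1 p.2) :
    Measurable fun p : ℝ × ℝ => interaction p.1 (F p.1) p.2 := by
  have hU : Measurable fun p : ℝ × ℝ => schr p.1 p.2 * F p.1 p.2 :=
    continuous_schr.measurable.mul hF
  have h1 : Measurable fun q : (ℝ × ℝ) × ℝ => (q.1.1, q.2) := by fun_prop
  have h2 : Measurable fun q : (ℝ × ℝ) × ℝ => (q.1.1, q.2 - q.1.2) := by fun_prop
  have h3 : StronglyMeasurable fun q : (ℝ × ℝ) × ℝ => (schr q.1.1 q.2 * F q.1.1 q.2) *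
      conj (schr q.1.1 (q.2 - q.1.2) * F q.1.1 (q.2 - q.1.2)) :=
    (Measurable.mul (hU.comp h1)
      (Complex.continuous_conj.measurable.comp (hU.comp h2))).stronglyMeasurable
  have h4 := h3.integral_prod_right' (ν := (volume : Measure ℝ))
  have h5 : Measurable fun p : ℝ × ℝ => conj (schr p.1 p.2) :=
    Complex.continuous_conj.measurable.comp continuous_schr.measurable
  exact Measurable.mul h5 h4.measurable

namespace IsMajorant

variable {A l S : ℝ} {f : ℝ → ℂ} {M : ℝ → ℝ}

theorem norm_quad_le (h : IsMajorant A l S f M) {K : ℝ} {G : ℝ → ℂ}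
    (hG : ∀ ξ, ‖G ξ‖ ≤ K * M ξ) (ξ : ℝ) : ‖quad G ξ‖ ≤ K ^ 2 * autocorr M ξ := by
  rw [autocorr, ← integral_const_mul]
  refine norm_integral_le_of_norm_le ((h.integrable_mul_sub ξ).const_mul _) (.of_forall fun η => ?_)
  rw [norm_mul, RCLike.norm_conj]
  calc _ ≤ (K * M η) * (K * M (η - ξ)) := by
        gcongr
        · exact (norm_nonneg _).trans (hG η)
        · exact hG η
        · exact hG _
    _ = _ := by ring

theorem integrable_quad (h : IsMajorant A l S f M) {K : ℝ} {G : ℝ → ℂ} (hm : Measurable G)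
    (hG : ∀ ξ, ‖G ξ‖ ≤ K * M ξ) (ξ : ℝ) : Integrable fun η => G η * conj (G (η - ξ)) := by
  refine ((h.integrable_mul_sub ξ).const_mul (K ^ 2)).mono' ?_ (.of_forall fun η => ?_)
  · exact (hm.mul (Complex.continuous_conj.measurable.comp
      (hm.comp (measurable_id.sub_const ξ)))).aestronglyMeasurable
  rw [norm_mul, RCLike.norm_conj]
  calc _ ≤ (K * M η) * (K * M (η - ξ)) := by
        gcongr
        · exact (norm_nonneg _).trans (hG η)
        · exact hG η
        · exact hG _
    _ = _ := by ring

theorem norm_quad_sub_le (h : IsMajorant A l S f M) {K d : ℝ} {G H : ℝ → ℂ} (hGm : Measurable G)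
    (hHm : Measurable H) (hG : ∀ ξ, ‖G ξ‖ ≤ K * M ξ) (hH : ∀ ξ, ‖H ξ‖ ≤ K * M ξ)
    (hd : ∀ ξ, ‖G ξ - H ξ‖ ≤ d * M ξ) (ξ : ℝ) :
    ‖quad G ξ - quad H ξ‖ ≤ 2 * K * d * autocorr M ξ := by
  rw [quad, quad, ← integral_sub (h.integrable_quad hGm hG ξ) (h.integrable_quad hHm hH ξ),
    autocorr, ← integral_const_mul]
  refine norm_integral_le_of_norm_le ((h.integrable_mul_sub ξ).const_mul _) (.of_forall fun η => ?_)
  calc _ = ‖(G η - H η) * conj (G (η - ξ)) + H η * conj (G (η - ξ) - H (η - ξ))‖ := by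
        rw [map_sub]; ring_nf
    _ ≤ ‖G η - H η‖ * ‖G (η - ξ)‖ + ‖H η‖ * ‖G (η - ξ) - H (η - ξ)‖ := by
        refine (norm_add_le _ _).trans_eq ?_
        rw [norm_mul, norm_mul, RCLike.norm_conj, RCLike.norm_conj]
    _ ≤ (d * M η) * (K * M (η - ξ)) + (K * M η) * (d * M (η - ξ)) := by
        gcongr
        · exact (norm_nonneg _).trans (hd η)
        · exact hd η
        · exact hG _
        · exact (norm_nonneg _).trans (hH η)
        · exact hH η
        · exact hd _
    _ = _ := by ring

theorem norm_interaction_le (h : IsMajorant A l S f M) {K : ℝ} {G : ℝ → ℂ}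
    (hG : ∀ ξ, ‖G ξ‖ ≤ K * M ξ) (τ ξ : ℝ) : ‖interaction τ G ξ‖ ≤ K ^ 2 * autocorr M ξ := by
  rw [interaction, norm_mul, RCLike.norm_conj, norm_schr, one_mul]
  exact h.norm_quad_le (fun ξ => by rw [norm_mul, norm_schr, one_mul]; exact hG ξ) ξ

theorem norm_interaction_sub_le (h : IsMajorant A l S f M) {K d : ℝ} {G H : ℝ → ℂ}
    (hGm : Measurable G) (hHm : Measurable H) (hG : ∀ ξ, ‖G ξ‖ ≤ K * M ξ)
    (hH : ∀ ξ, ‖H ξ‖ ≤ K * M ξ) (hd : ∀ ξ, ‖G ξ - H ξ‖ ≤ d * M ξ) (τ ξ : ℝ) :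
    ‖interaction τ G ξ - interaction τ H ξ‖ ≤ 2 * K * d * autocorr M ξ := by
  have hs : Measurable (schr τ) := (continuous_schr.comp (Continuous.prodMk_right τ)).measurable
  rw [interaction, interaction, ← mul_sub, norm_mul, RCLike.norm_conj, norm_schr, one_mul]
  refine h.norm_quad_sub_le (G := fun η => schr τ η * G η) (H := fun η => schr τ η * H η)
    (hs.mul hGm) (hs.mul hHm) ?_ ?_ ?_ ξ
  · exact fun ξ => by rw [norm_mul, norm_schr, one_mul]; exact hG ξ
  · exact fun ξ => by rw [norm_mul, norm_schr, one_mul]; exact hH ξ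
  · exact fun ξ => by rw [← mul_sub, norm_mul, norm_schr, one_mul]; exact hd ξ

theorem intervalIntegrable_interaction (h : IsMajorant A l S f M) {K : ℝ} {F : ℝ → ℝ → ℂ}
    (hm : Measurable fun p : ℝ × ℝ => F p.1 p.2) (hF : ∀ t ξ, ‖F t ξ‖ ≤ K * M ξ) (ξ a b : ℝ) :
    IntervalIntegrable (fun τ => interaction τ (F τ) ξ) volume a b := by
  refine (intervalIntegrable_const (c := K ^ 2 * autocorr M ξ)).mono_fun' ?_
    (.of_forall fun τ => h.norm_interaction_le (hF τ) τ ξ)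
  exact ((measurable_interaction hm).comp measurable_prodMk_right).aestronglyMeasurable

end IsMajorant

/-! ### Picard iteration under a majorant -/

/-- The projection of the line to `[0, T]`. -/
def timeProj (T t : ℝ) : ℝ := max 0 (min t T)

theorem timeProj_nonneg (T t : ℝ) : 0 ≤ timeProj T t := le_max_left _ _

theorem timeProj_le {T : ℝ} (hT : 0 ≤ T) (t : ℝ) : timeProj T t ≤ T :=
  max_le hT (min_le_right _ _)

theorem timeProj_of_mem {T t : ℝ} (ht : t ∈ Icc 0 T) : timeProj T t = t := by
  rw [timeProj, min_eq_left ht.2, max_eq_right ht.1]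

/-- With the moving endpoint turned into an indicator, this is a parametric integral over a fixed
space, and joint measurability is the Fubini statement. -/
theorem measurable_integral_timeProj (T : ℝ) {g : ℝ → ℝ → ℂ}
    (hg : Measurable fun p : ℝ × ℝ => g p.1 p.2) :
    Measurable fun p : ℝ × ℝ => ∫ τ in (0 : ℝ)..timeProj T p.1, g τ p.2 := by
  have hset : MeasurableSet {q : (ℝ × ℝ) × ℝ | 0 < q.2 ∧ q.2 ≤ timeProj T q.1.1} := by
    unfold timeProj
    have h0 : Measurable fun q : (ℝ × ℝ) × ℝ => max 0 (min q.1.1 T) := by fun_prop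
    exact (measurableSet_lt measurable_const measurable_snd).inter
      (measurableSet_le measurable_snd h0)
  have h1 : StronglyMeasurable fun q : (ℝ × ℝ) × ℝ =>
      {q : (ℝ × ℝ) × ℝ | 0 < q.2 ∧ q.2 ≤ timeProj T q.1.1}.indicator (fun q => g q.2 q.1.2) q :=
    ((hg.comp (by fun_prop : Measurable fun q : (ℝ × ℝ) × ℝ => (q.2, q.1.2))).indicator
      hset).stronglyMeasurable
  have h2 := (h1.integral_prod_right' (ν := (volume : Measure ℝ))).measurable
  refine (congrArg Measurable (funext fun p => ?_)).mpr h2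
  rw [intervalIntegral.integral_of_le (timeProj_nonneg T p.1),
    ← integral_indicator measurableSet_Ioc]
  rfl

/-- The Picard iterates for the equation in the interaction picture, on the Fourier side. -/
def picard (f : ℝ → ℂ) (T : ℝ) : ℕ → ℝ → ℝ → ℂ
  | 0 => fun _ ξ => f ξ
  | n + 1 => fun t ξ =>
      f ξ - Complex.I * ∫ τ in (0 : ℝ)..timeProj T t, interaction τ (picard f T n τ) ξ

theorem measurable_picard {f : ℝ → ℂ} (hf : Measurable f) (T : ℝ) (n : ℕ) :
    Measurable fun p : ℝ × ℝ => picard f T n p.1 p.2 := by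
  induction n with
  | zero => exact hf.comp measurable_snd
  | succ n ih =>
    exact (hf.comp measurable_snd).sub
      ((measurable_integral_timeProj T (measurable_interaction ih)).const_mul _)

/-- `F` solves the equation on `[0, T]` in the interaction picture on the Fourier side, with data
`f`, and is dominated by `2M`. -/
structure IsProfile (T : ℝ) (f : ℝ → ℂ) (M : ℝ → ℝ) (F : ℝ → ℝ → ℂ) : Prop where
  measurable : Measurable fun p : ℝ × ℝ => F p.1 p.2
  bound : ∀ t ξ, ‖F t ξ‖ ≤ 2 * M ξ
  equation : ∀ t ∈ Icc 0 T, ∀ ξ,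
    F t ξ = f ξ - Complex.I * ∫ τ in (0 : ℝ)..t, interaction τ (F τ) ξ

namespace IsMajorant

variable {A l S T : ℝ} {f : ℝ → ℂ} {M : ℝ → ℝ}

/-- The absorption step behind all the estimates: a small multiple of `M ⋆ M` is pointwise a small
multiple of `M`. -/
theorem mul_autocorr_le_of_le (h : IsMajorant A l S f M) {c r : ℝ} (hc : c ≤ r * A) (hr : 0 ≤ r)
    (ξ : ℝ) : c * autocorr M ξ ≤ r * M ξ :=
  calc c * autocorr M ξ ≤ r * A * autocorr M ξ :=
        mul_le_mul_of_nonneg_right hc (h.autocorr_nonneg ξ)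
    _ = r * (A * autocorr M ξ) := by ring
    _ ≤ _ := mul_le_mul_of_nonneg_left (h.mul_autocorr_le ξ) hr

theorem norm_picard_le (h : IsMajorant A l S f M) (hT : 0 ≤ T) (hA : 8 * T ≤ A) (n : ℕ) (t ξ : ℝ) :
    ‖picard f T n t ξ‖ ≤ 2 * M ξ := by
  have hf := h.norm_le (by linarith) ξ
  have hM := h.nonneg ξ
  induction n generalizing t ξ with
  | zero => exact hf.trans (by linarith)
  | succ n ih =>
    have hf := h.norm_le (by linarith) ξ
    have h1 : ‖∫ τ in (0 : ℝ)..timeProj T t, interaction τ (picard f T n τ) ξ‖ ≤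
        2 ^ 2 * autocorr M ξ * |timeProj T t - 0| :=
      intervalIntegral.norm_integral_le_of_norm_le_const fun τ _ => h.norm_interaction_le
        (fun ξ => ih τ ξ (h.norm_le (by linarith) ξ) (h.nonneg ξ)) τ ξ
    rw [sub_zero, abs_of_nonneg (timeProj_nonneg T t)] at h1
    have h2 := h.mul_autocorr_le_of_le (c := 4 * timeProj T t) (r := 1)
      (by linarith [timeProj_le hT t]) zero_le_one ξ
    calc _ ≤ ‖f ξ‖ + ‖∫ τ in (0 : ℝ)..timeProj T t, interaction τ (picard f T n τ) ξ‖ := by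
          refine (norm_sub_le _ _).trans_eq ?_
          rw [norm_mul, Complex.norm_I, one_mul]
      _ ≤ _ := by linarith

theorem norm_integral_interaction_sub_le (h : IsMajorant A l S f M) {F G : ℝ → ℝ → ℂ} {d t : ℝ}
    (ht : 0 ≤ t) (hFm : Measurable fun p : ℝ × ℝ => F p.1 p.2)
    (hGm : Measurable fun p : ℝ × ℝ => G p.1 p.2) (hF : ∀ t ξ, ‖F t ξ‖ ≤ 2 * M ξ)
    (hG : ∀ t ξ, ‖G t ξ‖ ≤ 2 * M ξ) (hd : ∀ τ ∈ Icc 0 t, ∀ ξ, ‖F τ ξ - G τ ξ‖ ≤ d * M ξ) (ξ : ℝ) :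
    ‖(∫ τ in (0 : ℝ)..t, interaction τ (F τ) ξ) - ∫ τ in (0 : ℝ)..t, interaction τ (G τ) ξ‖ ≤
      4 * d * t * autocorr M ξ := by
  rw [← intervalIntegral.integral_sub (h.intervalIntegrable_interaction hFm hF ξ 0 t)
    (h.intervalIntegrable_interaction hGm hG ξ 0 t)]
  refine (intervalIntegral.norm_integral_le_of_norm_le_const fun τ hτ =>
    h.norm_interaction_sub_le (hFm.comp measurable_prodMk_left)
      (hGm.comp measurable_prodMk_left) (hF τ) (hG τ) (hd τ ?_) τ ξ).trans_eq ?_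
  · rw [uIoc_of_le ht] at hτ
    exact ⟨hτ.1.le, hτ.2⟩
  · rw [sub_zero, abs_of_nonneg ht]; ring

/-- The difference of two quadratic terms costs a factor `4T` times `M ⋆ M`, and `8T ≤ A` turns this
into a contraction factor `1/2`, pointwise in frequency. -/
theorem norm_picard_succ_sub_le (h : IsMajorant A l S f M) (hf : Measurable f) (hT : 0 ≤ T)
    (hA : 8 * T ≤ A) (n : ℕ) (t ξ : ℝ) :
    ‖picard f T n t ξ - picard f T (n + 1) t ξ‖ ≤ (1 / 2) ^ n * M ξ := by
  have hp := timeProj_nonneg T t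
  have hp' := timeProj_le hT t
  induction n generalizing t ξ with
  | zero =>
    have h1 : ‖∫ τ in (0 : ℝ)..timeProj T t, interaction τ (picard f T 0 τ) ξ‖ ≤
        2 ^ 2 * autocorr M ξ * |timeProj T t - 0| :=
      intervalIntegral.norm_integral_le_of_norm_le_const fun τ _ => h.norm_interaction_le
        (h.norm_picard_le hT hA 0 τ) τ ξ
    rw [sub_zero, abs_of_nonneg hp] at h1
    have h2 := h.mul_autocorr_le_of_le (c := 4 * timeProj T t) (r := 1)
      (by linarith) zero_le_one ξ
    change ‖f ξ - (f ξ - Complex.I * ∫ τ in (0 : ℝ)..timeProj T t,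
      interaction τ (picard f T 0 τ) ξ)‖ ≤ _
    rw [sub_sub_cancel, norm_mul, Complex.norm_I, one_mul]
    linarith
  | succ n ih =>
    have h1 := h.norm_integral_interaction_sub_le hp (measurable_picard hf T (n + 1))
      (measurable_picard hf T n) (h.norm_picard_le hT hA (n + 1)) (h.norm_picard_le hT hA n)
      (d := (1 / 2) ^ n) (fun τ _ ξ => by
        rw [norm_sub_rev]; exact ih τ ξ (timeProj_nonneg T τ) (timeProj_le hT τ)) ξ
    have h2 := h.mul_autocorr_le_of_le (c := 4 * (1 / 2) ^ n * timeProj T t)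
      (r := (1 / 2) ^ (n + 1)) (by
        have : (0 : ℝ) < (1 / 2) ^ n := by positivity
        rw [pow_succ]; nlinarith) (by positivity) ξ
    refine le_trans (le_of_eq ?_) (h1.trans h2)
    change ‖f ξ - _ - (f ξ - _)‖ = _
    rw [sub_sub_sub_cancel_left, ← mul_sub, norm_mul, Complex.norm_I, one_mul]

theorem exists_isProfile (h : IsMajorant A l S f M) (hf : Measurable f) (hT : 0 ≤ T)
    (hA : 8 * T ≤ A) : ∃ F, IsProfile T f M F := by
  have hdist (t ξ : ℝ) (n : ℕ) :
      dist (picard f T n t ξ) (picard f T (n + 1) t ξ) ≤ M ξ * (1 / 2) ^ n := by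
    rw [dist_eq_norm, mul_comm]
    exact h.norm_picard_succ_sub_le hf hT hA n t ξ
  have hlim (t ξ : ℝ) : ∃ z, Tendsto (fun n => picard f T n t ξ) atTop (𝓝 z) :=
    cauchySeq_tendsto_of_complete (cauchySeq_of_le_geometric _ _ (by norm_num) (hdist t ξ))
  choose F hF using hlim
  have hmeas : Measurable fun p : ℝ × ℝ => F p.1 p.2 :=
    measurable_of_tendsto_metrizable (measurable_picard hf T)
      (tendsto_pi_nhds.2 fun p => hF p.1 p.2)
  have hbound (t ξ : ℝ) : ‖F t ξ‖ ≤ 2 * M ξ :=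
    le_of_tendsto (hF t ξ).norm (.of_forall fun n => h.norm_picard_le hT hA n t ξ)
  refine ⟨F, hmeas, hbound, fun t ht ξ => ?_⟩
  have hrate (n : ℕ) (τ ξ : ℝ) : ‖picard f T n τ ξ - F τ ξ‖ ≤ (2 * (1 / 2) ^ n) * M ξ := by
    have := dist_le_of_le_geometric_of_tendsto _ _ (by norm_num) (hdist τ ξ) (hF τ ξ) n
    rw [dist_eq_norm] at this
    refine this.trans_eq ?_
    ring
  refine tendsto_nhds_unique ((tendsto_add_atTop_iff_nat 1).2 (hF t ξ)) ?_
  rw [tendsto_iff_norm_sub_tendsto_zero]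
  have hz : Tendsto (fun n : ℕ => 4 * (2 * (1 / 2 : ℝ) ^ n) * t * autocorr M ξ) atTop (𝓝 0) := by
    have := ((((tendsto_pow_atTop_nhds_zero_of_lt_one (r := (1 / 2 : ℝ)) (by norm_num)
      (by norm_num)).const_mul 2).const_mul 4).mul_const t).mul_const (autocorr M ξ)
    simpa using this
  refine squeeze_zero (fun _ => norm_nonneg _) (fun n => ?_) hz
  have h1 := h.norm_integral_interaction_sub_le ht.1 (measurable_picard hf T n) hmeas
    (h.norm_picard_le hT hA n) hbound (fun τ _ ξ => hrate n τ ξ) ξ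
  refine le_trans (le_of_eq ?_) h1
  change ‖f ξ - Complex.I * (∫ τ in (0 : ℝ)..timeProj T t, _) - (f ξ - _)‖ = _
  rw [timeProj_of_mem ht, sub_sub_sub_cancel_left, ← mul_sub, norm_mul, Complex.norm_I, one_mul,
    norm_sub_rev]

end IsMajorant

theorem IsProfile.norm_sub_duhamel_le {A l S T : ℝ} {f : ℝ → ℂ} {M : ℝ → ℝ} {F : ℝ → ℝ → ℂ}
    (hF : IsProfile T f M F) (h : IsMajorant A l S f M) (hf : Measurable f) (hA : 0 < A) {t : ℝ}
    (ht : t ∈ Icc 0 T) (ξ : ℝ) :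
    ‖F t ξ - (f ξ - Complex.I * ∫ τ in (0 : ℝ)..t, interaction τ f ξ)‖ ≤
      16 * t ^ 2 / A * autocorr M ξ := by
  -- The first-order deviation `|F - f| ≤ (4t/A) M`; put back into the quadratic term it costs
  -- another `4t`, whence `16 t² / A`.
  have hd : ∀ τ ∈ Icc 0 t, ∀ ξ, ‖F τ ξ - f ξ‖ ≤ (4 * t / A) * M ξ := by
    intro τ hτ ξ
    rw [hF.equation τ ⟨hτ.1, hτ.2.trans ht.2⟩ ξ, sub_sub_cancel_left, norm_neg, norm_mul,
      Complex.norm_I, one_mul]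
    have h1 : ‖∫ τ in (0 : ℝ)..τ, interaction τ (F τ) ξ‖ ≤ 2 ^ 2 * autocorr M ξ * |τ - 0| :=
      intervalIntegral.norm_integral_le_of_norm_le_const fun τ _ => h.norm_interaction_le
        (hF.bound τ) τ ξ
    rw [sub_zero, abs_of_nonneg hτ.1] at h1
    have h2 := h.mul_autocorr_le_of_le (c := 4 * τ) (r := 4 * t / A)
      (by rw [div_mul_cancel₀ _ hA.ne']; linarith [hτ.2])
      (div_nonneg (by linarith [ht.1]) hA.le) ξ
    linarith
  have hf2 : ∀ (t : ℝ) (ξ : ℝ), ‖f ξ‖ ≤ 2 * M ξ := fun _ ξ =>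
    (h.norm_le hA.le ξ).trans (by linarith [h.nonneg ξ])
  have h1 := h.norm_integral_interaction_sub_le ht.1 hF.measurable
    (G := fun _ => f) (hf.comp measurable_snd) hF.bound hf2 hd ξ
  rw [hF.equation t ht ξ, sub_sub_sub_cancel_left, ← mul_sub, norm_mul, Complex.norm_I, one_mul,
    norm_sub_rev]
  refine h1.trans_eq ?_
  ring

/-! ### From profiles to `L²` solutions -/

/-- The Fourier transform at time `t` of the solution with profile `F`. -/
def wave (F : ℝ → ℝ → ℂ) (t ξ : ℝ) : ℂ := schr t ξ * F t ξ

@[simp]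
theorem norm_wave (F : ℝ → ℝ → ℂ) (t ξ : ℝ) : ‖wave F t ξ‖ = ‖F t ξ‖ := by
  rw [wave, norm_mul, norm_schr, one_mul]

theorem quad_wave (F : ℝ → ℝ → ℂ) (t ξ : ℝ) :
    quad (wave F t) ξ = schr t ξ * interaction t (F t) ξ := by
  rw [interaction, ← mul_assoc, schr_mul_conj, one_mul]
  rfl

namespace IsMajorant

variable {A l S : ℝ} {f : ℝ → ℂ} {M : ℝ → ℝ}

theorem integrable_sq (h : IsMajorant A l S f M) : Integrable fun ξ => M ξ ^ 2 := by
  refine (h.integrable_mul_sub 0).congr (.of_forall fun ξ => ?_)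
  simp only [sub_zero]
  ring

theorem memLp_of_norm_le (h : IsMajorant A l S f M) {K : ℝ} {G : ℝ → ℂ} (hG : Measurable G)
    (hb : ∀ ξ, ‖G ξ‖ ≤ K * M ξ) : MemLp G 2 volume := by
  rw [memLp_two_iff_integrable_sq_norm hG.aestronglyMeasurable]
  refine (h.integrable_sq.const_mul (K ^ 2)).mono' (by fun_prop) (.of_forall fun ξ => ?_)
  rw [Real.norm_of_nonneg (by positivity), ← mul_pow]
  exact pow_le_pow_left₀ (norm_nonneg _) (hb ξ) 2

theorem integrable_of_norm_le (h : IsMajorant A l S f M) {K : ℝ} {G : ℝ → ℂ} (hG : Measurable G)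
    (hb : ∀ ξ, ‖G ξ‖ ≤ K * M ξ) : Integrable G :=
  (h.integrable.const_mul K).mono' hG.aestronglyMeasurable (.of_forall hb)

end IsMajorant

namespace IsProfile

variable {A l S T : ℝ} {f : ℝ → ℂ} {M : ℝ → ℝ} {F : ℝ → ℝ → ℂ}

theorem measurable_wave_prod (hF : IsProfile T f M F) :
    Measurable fun p : ℝ × ℝ => wave F p.1 p.2 :=
  continuous_schr.measurable.mul hF.measurable

theorem measurable_wave (hF : IsProfile T f M F) (t : ℝ) : Measurable fun ξ => wave F t ξ :=
  Measurable.comp (g := fun p : ℝ × ℝ => wave F p.1 p.2) (f := fun ξ => (t, ξ))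
    hF.measurable_wave_prod measurable_prodMk_left

theorem norm_wave_le (hF : IsProfile T f M F) (t ξ : ℝ) : ‖wave F t ξ‖ ≤ 2 * M ξ := by
  rw [norm_wave]; exact hF.bound t ξ

theorem memLp_wave (hF : IsProfile T f M F) (h : IsMajorant A l S f M) (t : ℝ) :
    MemLp (wave F t) 2 volume := h.memLp_of_norm_le (hF.measurable_wave t) (hF.norm_wave_le t)

theorem wave_zero (hF : IsProfile T f M F) (hT : 0 ≤ T) : wave F 0 = f := by
  funext ξ
  rw [wave, schr_zero, one_mul, hF.equation 0 ⟨le_rfl, hT⟩ ξ, intervalIntegral.integral_same]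
  simp

theorem continuousOn_profile (hF : IsProfile T f M F) (h : IsMajorant A l S f M) (ξ : ℝ) :
    ContinuousOn (fun t => F t ξ) (Icc 0 T) := by
  have h1 : Continuous fun t => f ξ - Complex.I * ∫ τ in (0 : ℝ)..t, interaction τ (F τ) ξ :=
    continuous_const.sub (continuous_const.mul (intervalIntegral.continuous_primitive
      (h.intervalIntegrable_interaction hF.measurable hF.bound ξ) 0))
  exact h1.continuousOn.congr fun t ht => hF.equation t ht ξ

theorem continuous_schr_left (ξ : ℝ) : Continuous fun t => schr t ξ :=
  continuous_schr.comp (Continuous.prodMk_left ξ)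

theorem continuousOn_wave (hF : IsProfile T f M F) (h : IsMajorant A l S f M) (ξ : ℝ) :
    ContinuousOn (fun t => wave F t ξ) (Icc 0 T) :=
  (continuous_schr_left ξ).continuousOn.mul (hF.continuousOn_profile h ξ)

theorem continuousOn_quad_wave (hF : IsProfile T f M F) (h : IsMajorant A l S f M) (ξ : ℝ) :
    ContinuousOn (fun t => quad (wave F t) ξ) (Icc 0 T) := by
  intro t ht
  refine continuousWithinAt_of_dominated (bound := fun η => 2 ^ 2 * (M η * M (η - ξ)))
    (.of_forall fun τ => ?_) (.of_forall fun τ => .of_forall fun η => ?_)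
    ((h.integrable_mul_sub ξ).const_mul _) (.of_forall fun η => ?_)
  · exact (h.integrable_quad (hF.measurable_wave τ) (hF.norm_wave_le τ) ξ).aestronglyMeasurable
  · rw [norm_mul, RCLike.norm_conj]
    calc _ ≤ (2 * M η) * (2 * M (η - ξ)) := by
          gcongr
          · exact (norm_nonneg _).trans (hF.norm_wave_le τ η)
          · exact hF.norm_wave_le τ η
          · exact hF.norm_wave_le τ _
      _ = _ := by ring
  · exact (hF.continuousOn_wave h η t ht).mul
      (Complex.continuous_conj.continuousAt.comp_continuousWithinAt
        (hF.continuousOn_wave h (η - ξ) t ht))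

theorem continuousOn_interaction (hF : IsProfile T f M F) (h : IsMajorant A l S f M) (ξ : ℝ) :
    ContinuousOn (fun t => interaction t (F t) ξ) (Icc 0 T) :=
  (Complex.continuous_conj.comp (continuous_schr_left ξ)).continuousOn.mul
    (hF.continuousOn_quad_wave h ξ)

theorem hasDerivAt_wave (hF : IsProfile T f M F) (h : IsMajorant A l S f M) (ξ : ℝ) {t : ℝ}
    (ht : t ∈ Ioo 0 T) : HasDerivAt (fun t => wave F t ξ)
      (Complex.I * (-(4 * Real.pi ^ 2 * ξ ^ 2 : ℝ) * wave F t ξ) -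
        Complex.I * quad (wave F t) ξ) t := by
  have hnhds : Icc 0 T ∈ 𝓝 t := Icc_mem_nhds ht.1 ht.2
  have h1 : HasDerivAt (fun t => ∫ τ in (0 : ℝ)..t, interaction τ (F τ) ξ)
      (interaction t (F t) ξ) t := by
    refine intervalIntegral.integral_hasDerivAt_right
      (h.intervalIntegrable_interaction hF.measurable hF.bound ξ 0 t) ?_
      ((hF.continuousOn_interaction h ξ).continuousAt hnhds)
    exact ((measurable_interaction hF.measurable).comp
      measurable_prodMk_right).stronglyMeasurable.stronglyMeasurableAtFilter
  have h2 : HasDerivAt (fun t => F t ξ) (-(Complex.I * interaction t (F t) ξ)) t := by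
    have := (h1.const_mul Complex.I).const_sub (f ξ)
    refine this.congr_of_eventuallyEq ?_
    filter_upwards [hnhds] with τ hτ using hF.equation τ hτ ξ
  have h3 : HasDerivAt (fun t => schr t ξ)
      (schr t ξ * ((-(4 * Real.pi ^ 2 * ξ ^ 2) : ℝ) * Complex.I)) t := by
    have h4 : HasDerivAt (fun t : ℝ => -(4 * Real.pi ^ 2 * t * ξ ^ 2))
        (-(4 * Real.pi ^ 2 * ξ ^ 2)) t := by
      have := ((hasDerivAt_id t).const_mul (4 * Real.pi ^ 2)).mul_const (ξ ^ 2)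
      rw [mul_one] at this
      exact this.neg
    exact (h4.ofReal_comp.mul_const Complex.I).cexp
  refine (h3.mul h2).congr_deriv ?_
  rw [quad_wave, wave]
  push_cast
  ring

/-- At each fixed frequency the equation is an ordinary differential equation in time, so this is
the fundamental theorem of calculus. -/
theorem wave_sub_eq_integral (hF : IsProfile T f M F) (h : IsMajorant A l S f M) (ξ : ℝ) {t : ℝ}
    (ht : t ∈ Icc 0 T) : wave F t ξ - f ξ =
      Complex.I * (∫ τ in (0 : ℝ)..t, -(4 * Real.pi ^ 2 * ξ ^ 2 : ℝ) * wave F τ ξ) -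
        Complex.I * ∫ τ in (0 : ℝ)..t, quad (wave F τ) ξ := by
  have hsub : Icc 0 t ⊆ Icc 0 T := Icc_subset_Icc_right ht.2
  have hi1 : IntervalIntegrable (fun τ => -(4 * Real.pi ^ 2 * ξ ^ 2 : ℝ) * wave F τ ξ)
      volume 0 t := by
    refine ContinuousOn.intervalIntegrable ?_
    rw [uIcc_of_le ht.1]
    exact continuousOn_const.mul ((hF.continuousOn_wave h ξ).mono hsub)
  have hi2 : IntervalIntegrable (fun τ => quad (wave F τ) ξ) volume 0 t := by
    refine ContinuousOn.intervalIntegrable ?_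
    rw [uIcc_of_le ht.1]
    exact (hF.continuousOn_quad_wave h ξ).mono hsub
  have h1 := intervalIntegral.integral_eq_sub_of_hasDerivAt_of_le ht.1
    ((hF.continuousOn_wave h ξ).mono hsub)
    (fun τ hτ => hF.hasDerivAt_wave h ξ ⟨hτ.1, hτ.2.trans_le ht.2⟩)
    ((hi1.const_mul _).sub (hi2.const_mul _))
  rw [hF.wave_zero (ht.1.trans ht.2)] at h1
  rw [← h1, intervalIntegral.integral_sub (hi1.const_mul _) (hi2.const_mul _),
    intervalIntegral.integral_const_mul Complex.I, intervalIntegral.integral_const_mul Complex.I]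

theorem tendsto_eLpNorm_wave_sub (hF : IsProfile T f M F) (h : IsMajorant A l S f M) {t : ℝ}
    (ht : t ∈ Icc 0 T) :
    Tendsto (fun τ => eLpNorm (wave F τ - wave F t) 2 volume) (𝓝[Icc 0 T] t) (𝓝 0) := by
  have h1 : Tendsto (fun τ => ∫⁻ ξ, ‖wave F τ ξ - wave F t ξ‖ₑ ^ (2 : ℝ)) (𝓝[Icc 0 T] t)
      (𝓝 (∫⁻ _ : ℝ, 0)) := by
    refine tendsto_lintegral_filter_of_dominated_convergence
      (fun ξ => ‖(4 * M ξ) ^ 2‖ₑ) (.of_forall fun τ => ?_)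
      (.of_forall fun τ => .of_forall fun ξ => ?_) ?_ (.of_forall fun ξ => ?_)
    · have := hF.measurable_wave τ
      have := hF.measurable_wave t
      fun_prop
    · have hle : ‖wave F τ ξ - wave F t ξ‖ ≤ 4 * M ξ := by
        linarith [norm_sub_le (wave F τ ξ) (wave F t ξ), hF.norm_wave_le τ ξ, hF.norm_wave_le t ξ]
      rw [enorm_pow, ENNReal.rpow_ofNat]
      gcongr
      exact enorm_le_iff_norm_le.2 (hle.trans (Real.le_norm_self _))
    · have := h.integrable_sq.const_mul 16
      have h2 : Integrable fun ξ => (4 * M ξ) ^ 2 :=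
        this.congr (.of_forall fun ξ => by simp only; ring)
      exact h2.hasFiniteIntegral.ne
    · have h3 : Tendsto (fun τ => wave F τ ξ - wave F t ξ) (𝓝[Icc 0 T] t) (𝓝 0) := by
        have := (hF.continuousOn_wave h ξ t ht).tendsto.sub_const (wave F t ξ)
        rwa [sub_self] at this
      have h4 := (ENNReal.continuous_rpow_const (y := (2 : ℝ))).tendsto 0
      rw [ENNReal.zero_rpow_of_pos (by norm_num)] at h4
      exact h4.comp (by simpa using h3.enorm)
  rw [lintegral_zero] at h1
  have h2 := (ENNReal.continuous_rpow_const (y := (1 / 2 : ℝ))).tendsto 0 |>.comp h1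
  rw [ENNReal.zero_rpow_of_pos (by norm_num)] at h2
  refine h2.congr fun τ => ?_
  rw [eLpNorm_eq_lintegral_rpow_enorm_toReal (by norm_num) (by norm_num)]
  simp

theorem continuousOn_invFourier_wave (hF : IsProfile T f M F) (h : IsMajorant A l S f M) :
    ContinuousOn (fun t => invFourier (wave F t) (hF.memLp_wave h t)) (Icc 0 T) := by
  intro t ht
  refine (Lp.fourierTransformₗᵢ ℝ ℂ).symm.continuous.continuousAt.tendsto.comp ?_
  exact (Lp.tendsto_Lp_iff_tendsto_eLpNorm'' _ (hF.memLp_wave h) _ (hF.memLp_wave h t)).2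
    (hF.tendsto_eLpNorm_wave_sub h ht)

theorem integrable_wave_mul (hF : IsProfile T f M F) (h : IsMajorant A l S f M) (t : ℝ)
    {g : ℝ → ℂ} (hg : Integrable g) :
    Integrable (fun p : ℝ × ℝ => wave F p.1 p.2 * g p.2)
      ((volume.restrict (Ioc 0 t)).prod volume) := by
  refine (hg.comp_snd (volume.restrict (Ioc 0 t))).bdd_mul (c := 2 * (2 * S))
    hF.measurable_wave_prod.aestronglyMeasurable (.of_forall fun p => ?_)
  exact (hF.norm_wave_le _ _).trans (by linarith [h.le_bound p.2])

theorem integrable_quad_wave_mul (hF : IsProfile T f M F) (h : IsMajorant A l S f M) (t : ℝ)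
    {g : ℝ → ℂ} (hg : Integrable g) :
    Integrable (fun p : ℝ × ℝ => quad (wave F p.1) p.2 * g p.2)
      ((volume.restrict (Ioc 0 t)).prod volume) := by
  refine (hg.comp_snd (volume.restrict (Ioc 0 t))).bdd_mul (c := 2 ^ 2 * (4 * l * S))
    ?_ (.of_forall fun p => ?_)
  · simp_rw [quad_wave]
    exact (continuous_schr.measurable.mul
      (measurable_interaction hF.measurable)).aestronglyMeasurable
  · exact (h.norm_quad_le (hF.norm_wave_le _) _).trans (by gcongr; exact h.autocorr_le _)

theorem isL2Solution (hF : IsProfile T f M F) (h : IsMajorant A l S f M) (hT : 0 ≤ T)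
    (hf : MemLp f 2 volume) :
    IsL2Solution T (invFourier f hf) fun t => invFourier (wave F t) (hF.memLp_wave h t) where
  continuousOn := hF.continuousOn_invFourier_wave h
  initial := by simp only [hF.wave_zero hT]
  equation := by
    intro t ht φ
    have hW1 (τ : ℝ) : Integrable (wave F τ) :=
      h.integrable_of_norm_le (hF.measurable_wave τ) (hF.norm_wave_le τ)
    have hf1 : Integrable f := hF.wave_zero hT ▸ hW1 0
    set ψ : 𝓢(ℝ, ℂ) := 𝓕⁻ φ with hψ
    have hψ1 : Integrable (ψ : ℝ → ℂ) := ψ.integrable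
    have hψb (G : ℝ → ℂ) (hG : Integrable G) : Integrable fun ξ => G ξ * ψ ξ :=
      hG.mul_bdd (c := ‖ψ.toBoundedContinuousFunction‖) ψ.continuous.aestronglyMeasurable
        (.of_forall fun ξ => ψ.toBoundedContinuousFunction.norm_coe_le_norm ξ)
    have hψ2 : Integrable fun ξ => -(4 * Real.pi ^ 2 * ξ ^ 2 : ℝ) * ψ ξ := by
      refine ((ψ.integrable_pow_mul volume 2).const_mul (4 * Real.pi ^ 2)).mono' ?_
        (.of_forall fun ξ => ?_)
      · exact (by fun_prop : Continuous fun ξ : ℝ =>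
          (-(4 * Real.pi ^ 2 * ξ ^ 2 : ℝ) : ℂ) * ψ ξ).aestronglyMeasurable
      · rw [norm_mul, norm_neg, Complex.norm_real, Real.norm_of_nonneg (by positivity),
          Real.norm_eq_abs, sq_abs, mul_assoc]
    have hS (τ ξ : ℝ) : ‖wave F τ ξ‖ ≤ 2 * (2 * S) :=
      (hF.norm_wave_le _ _).trans (by linarith [h.le_bound ξ])
    simp_rw [integral_invFourier_mul_deriv_deriv,
      integral_invFourier_mul_conj_mul (hF.memLp_wave h _) (hW1 _) (hS _),
      integral_invFourier_mul, ← hψ]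
    change _ = ∫ τ in (0 : ℝ)..t, ∫ ξ, quad (wave F τ) ξ * ψ ξ
    have hp1 := hF.integrable_wave_mul h t hψ2
    have hp2 := hF.integrable_quad_wave_mul h t hψ1
    rw [← integral_sub (hψb _ (hW1 t)) (hψb _ hf1)]
    have hpt (ξ : ℝ) : wave F t ξ * ψ ξ - f ξ * ψ ξ =
        Complex.I * (∫ τ in (0 : ℝ)..t, wave F τ ξ * (-(4 * Real.pi ^ 2 * ξ ^ 2 : ℝ) * ψ ξ)) -
          Complex.I * ∫ τ in (0 : ℝ)..t, quad (wave F τ) ξ * ψ ξ := by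
      rw [← sub_mul, hF.wave_sub_eq_integral h ξ ht, intervalIntegral.integral_mul_const,
        intervalIntegral.integral_mul_const, intervalIntegral.integral_const_mul]
      ring
    simp_rw [hpt, intervalIntegral.integral_of_le ht.1]
    -- Integrating the frequencywise identity against `ψ` leaves only an exchange of time and
    -- frequency integrals; the decay of `ψ` absorbs the factor `ξ²`.
    have e1 := integral_integral_swap (f := fun τ ξ =>
      wave F τ ξ * (-(4 * Real.pi ^ 2 * ξ ^ 2 : ℝ) * ψ ξ)) hp1
    have e2 := integral_integral_swap (f := fun τ ξ => quad (wave F τ) ξ * ψ ξ) hp2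
    rw [integral_sub (hp1.integral_prod_right.const_mul _) (hp2.integral_prod_right.const_mul _),
      integral_const_mul, integral_const_mul, ← e1, ← e2]
    ring_nf
    simp only [Complex.I_sq]
    ring

end IsProfile

theorem exists_isMajorant_isProfile {f : ℝ → ℂ} (hf : Measurable f) (hfi : Integrable f)
    {T A l S : ℝ} (hT : 0 ≤ T) (hTA : 8 * T ≤ A) (hl : ∫ ξ, ‖f ξ‖ ≤ l) (hA : 4 * A * l ≤ 1)
    (hS : ∀ ξ, ‖f ξ‖ ≤ S) : ∃ M F, IsMajorant A l S f M ∧ IsProfile T f M F := by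
  obtain ⟨M, hM⟩ := exists_isMajorant hf hfi (by linarith) hl hA hS
  obtain ⟨F, hF⟩ := hM.exists_isProfile hf hT hTA
  exact ⟨M, F, hM, hF⟩

/-! ### Lower bounds from the first Duhamel term -/

theorem half_le_cos {x : ℝ} (hx : |x| ≤ 1) : 1 / 2 ≤ Real.cos x := by
  have h1 := Real.one_sub_sq_div_two_le_cos (x := x)
  have h2 : x ^ 2 ≤ 1 := by rw [← sq_abs]; exact pow_le_one₀ (abs_nonneg x) hx
  linarith

/-- The resonance identity `ξ² - η² + (η - ξ)² = 2ξ(ξ - η)`. -/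
theorem interaction_ofReal (f : ℝ → ℝ) (τ ξ : ℝ) :
    interaction τ (fun η => (f η : ℂ)) ξ =
      ∫ η, Complex.exp ((8 * Real.pi ^ 2 * τ * ξ * (ξ - η) : ℝ) * Complex.I) *
        (f η * f (η - ξ) : ℝ) := by
  rw [interaction, quad, ← integral_const_mul]
  refine integral_congr_ae (.of_forall fun η => ?_)
  simp only [schr, map_mul, ← Complex.exp_conj, Complex.conj_ofReal, Complex.conj_I]
  have e : Complex.exp ((8 * Real.pi ^ 2 * τ * ξ * (ξ - η) : ℝ) * Complex.I) =
      Complex.exp ((-(4 * Real.pi ^ 2 * τ * ξ ^ 2) : ℝ) * -Complex.I) *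
      Complex.exp ((-(4 * Real.pi ^ 2 * τ * η ^ 2) : ℝ) * Complex.I) *
      Complex.exp ((-(4 * Real.pi ^ 2 * τ * (η - ξ) ^ 2) : ℝ) * -Complex.I) := by
    rw [← Complex.exp_add, ← Complex.exp_add]
    congr 1
    push_cast
    ring
  rw [e]
  push_cast
  ring

theorem half_autocorr_le_re_interaction {f : ℝ → ℝ} {τ ξ : ℝ}
    (hi : Integrable fun η => f η * f (η - ξ)) (hnn : ∀ η, 0 ≤ f η)
    (hphase : ∀ η, f η * f (η - ξ) ≠ 0 → |8 * Real.pi ^ 2 * τ * ξ * (ξ - η)| ≤ 1) :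
    autocorr f ξ / 2 ≤ (interaction τ (fun η => (f η : ℂ)) ξ).re := by
  have hint : Integrable fun η => Complex.exp
      ((8 * Real.pi ^ 2 * τ * ξ * (ξ - η) : ℝ) * Complex.I) * (f η * f (η - ξ) : ℝ) := by
    refine hi.ofReal.bdd_mul (c := 1) ?_ (.of_forall fun η => ?_)
    · exact (by fun_prop : Continuous fun η : ℝ => Complex.exp
        ((8 * Real.pi ^ 2 * τ * ξ * (ξ - η) : ℝ) * Complex.I)).aestronglyMeasurable
    · rw [Complex.norm_exp_ofReal_mul_I]
  rw [interaction_ofReal]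
  have hre := integral_re hint
  simp only [RCLike.re_to_complex] at hre
  rw [← hre, autocorr, ← integral_div]
  refine integral_mono (hi.div_const 2) hint.re fun η => ?_
  simp only
  rw [Complex.re_mul_ofReal, Complex.exp_ofReal_mul_I_re]
  by_cases h0 : f η * f (η - ξ) = 0
  · rw [h0]; simp
  · have := half_le_cos (hphase η h0)
    nlinarith [mul_nonneg (hnn η) (hnn (η - ξ))]

namespace IsProfile

variable {A l S T : ℝ} {f : ℝ → ℝ} {M : ℝ → ℝ} {F : ℝ → ℝ → ℂ}

/-- Outside the support of the data only the Duhamel term contributes. Its integrand has real part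
at least half the autocorrelation at every time up to `t`, and the remainder is subtracted. -/
theorem le_norm_of_phase_le (hF : IsProfile T (fun η => (f η : ℂ)) M F)
    (h : IsMajorant A l S (fun η => (f η : ℂ)) M) (hm : Measurable f) (hA : 0 < A)
    (hnn : ∀ η, 0 ≤ f η) {t ξ : ℝ} (ht : t ∈ Icc 0 T) (hξ : f ξ = 0)
    (hphase : ∀ η, f η * f (η - ξ) ≠ 0 → 8 * Real.pi ^ 2 * t * |ξ * (ξ - η)| ≤ 1) :
    t * (autocorr f ξ / 2) - 16 * t ^ 2 / A * autocorr M ξ ≤ ‖F t ξ‖ := by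
  have hfM (η : ℝ) : |f η| ≤ M η := by simpa using h.norm_le hA.le η
  have hi : Integrable fun η => f η * f (η - ξ) := by
    refine (h.integrable_mul_sub ξ).mono' (by fun_prop) (.of_forall fun η => ?_)
    rw [norm_mul]
    exact mul_le_mul (hfM _) (hfM _) (norm_nonneg _) (h.nonneg _)
  have hii := h.intervalIntegrable_interaction (F := fun _ η => (f η : ℂ)) (K := 1)
    ((Complex.measurable_ofReal.comp hm).comp measurable_snd)
    (fun _ η => by rw [one_mul]; exact h.norm_le hA.le η) ξ 0 t
  have h1 : t * (autocorr f ξ / 2) ≤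
      ‖∫ τ in (0 : ℝ)..t, interaction τ (fun η => (f η : ℂ)) ξ‖ := by
    refine le_trans ?_ (Complex.re_le_norm _)
    have hre : (∫ τ in (0 : ℝ)..t, interaction τ (fun η => (f η : ℂ)) ξ).re =
        ∫ τ in (0 : ℝ)..t, (interaction τ (fun η => (f η : ℂ)) ξ).re :=
      (Complex.reCLM.intervalIntegral_comp_comm hii).symm
    rw [hre]
    have hc : ∫ _ in (0 : ℝ)..t, autocorr f ξ / 2 = t * (autocorr f ξ / 2) := by
      rw [intervalIntegral.integral_const, sub_zero, smul_eq_mul]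
    rw [← hc]
    refine intervalIntegral.integral_mono_on ht.1 intervalIntegrable_const
      ⟨hii.1.re, hii.2.re⟩ fun τ hτ => ?_
    refine half_autocorr_le_re_interaction hi hnn fun η hη => ?_
    calc |8 * Real.pi ^ 2 * τ * ξ * (ξ - η)| = 8 * Real.pi ^ 2 * τ * |ξ * (ξ - η)| := by
          rw [mul_assoc (8 * Real.pi ^ 2 * τ), abs_mul,
            abs_of_nonneg (by have := hτ.1; positivity)]
      _ ≤ 8 * Real.pi ^ 2 * t * |ξ * (ξ - η)| := by
          have := hτ.2
          gcongr
      _ ≤ 1 := hphase η hη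
  have h2 := hF.norm_sub_duhamel_le h (Complex.measurable_ofReal.comp hm) hA ht ξ
  have h3 := norm_sub_norm_le ((f ξ : ℂ) - Complex.I *
    ∫ τ in (0 : ℝ)..t, interaction τ (fun η => (f η : ℂ)) ξ) (F t ξ)
  rw [norm_sub_rev _ (F t ξ)] at h3
  have h4 : ‖(f ξ : ℂ) - Complex.I * ∫ τ in (0 : ℝ)..t, interaction τ (fun η => (f η : ℂ)) ξ‖ =
      ‖∫ τ in (0 : ℝ)..t, interaction τ (fun η => (f η : ℂ)) ξ‖ := by
    rw [hξ, Complex.ofReal_zero, zero_sub, norm_neg, norm_mul, Complex.norm_I, one_mul]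
  linarith

theorem norm_le_of_mul_eq_zero (hF : IsProfile T (fun η => (f η : ℂ)) M F)
    (h : IsMajorant A l S (fun η => (f η : ℂ)) M) (hm : Measurable f) (hA : 0 < A)
    {t ξ : ℝ} (ht : t ∈ Icc 0 T) (hξ : f ξ = 0) (h0 : ∀ η, f η * f (η - ξ) = 0) :
    ‖F t ξ‖ ≤ 16 * t ^ 2 / A * autocorr M ξ := by
  have h2 := hF.norm_sub_duhamel_le h (Complex.measurable_ofReal.comp hm) hA ht ξ
  have h3 (τ : ℝ) : interaction τ (fun η => (f η : ℂ)) ξ = 0 := by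
    rw [interaction_ofReal]
    simp [h0]
  simpa [h3, hξ] using h2

end IsProfile

theorem IsMajorant.zero (A : ℝ) : IsMajorant A 0 0 (fun _ => 0) (fun _ => 0) where
  measurable := measurable_const
  le := by simp [autocorr]
  nonneg := by simp
  integrable := integrable_zero _ _ _
  integral_le := by simp
  le_bound := by simp

theorem IsProfile.zero (T : ℝ) : IsProfile T (fun _ => 0) (fun _ => 0) (fun _ _ => 0) where
  measurable := measurable_const
  bound := by simp
  equation := by simp [interaction, quad]

/-! ### Box data and weighted norms -/

/-- The function `c` on `[p, q]`, zero elsewhere. -/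
def box (c p q : ℝ) : ℝ → ℝ := (Icc p q).indicator fun _ => c

section box

variable {c p q : ℝ}

theorem box_of_mem {ξ : ℝ} (h : ξ ∈ Icc p q) : box c p q ξ = c := indicator_of_mem h _

theorem box_of_notMem {ξ : ℝ} (h : ξ ∉ Icc p q) : box c p q ξ = 0 := indicator_of_notMem h _

@[fun_prop]
theorem measurable_box : Measurable (box c p q) := measurable_const.indicator measurableSet_Icc

theorem integrable_box : Integrable (box c p q) :=
  (integrable_indicator_iff measurableSet_Icc).2 (integrableOn_const (by simp))

theorem integral_box (h : p ≤ q) : ∫ ξ, box c p q ξ = c * (q - p) := by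
  rw [box, integral_indicator measurableSet_Icc, setIntegral_const, Real.volume_real_Icc_of_le h,
    smul_eq_mul, mul_comm]

theorem box_nonneg (hc : 0 ≤ c) (ξ : ℝ) : 0 ≤ box c p q ξ := indicator_nonneg (fun _ _ => hc) ξ

theorem box_le (hc : 0 ≤ c) (ξ : ℝ) : box c p q ξ ≤ c :=
  indicator_le_self' (fun _ _ => hc) ξ

theorem eLpNorm_box (hc : 0 ≤ c) (h : p ≤ q) :
    eLpNorm (box c p q) 2 volume = ENNReal.ofReal (c * √(q - p)) := by
  rw [box, eLpNorm_indicator_const measurableSet_Icc (by norm_num) (by norm_num),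
    Real.volume_Icc, ENNReal.ofReal_mul hc, Real.sqrt_eq_rpow,
    ← ENNReal.ofReal_rpow_of_nonneg (sub_nonneg.2 h) (by norm_num), Real.enorm_of_nonneg hc]
  norm_num

end box

theorem hsaWeight_nonneg (s a ξ : ℝ) : 0 ≤ hsaWeight s a ξ := by
  unfold hsaWeight; split_ifs <;> positivity

theorem measurable_hsaWeight (s a : ℝ) : Measurable (hsaWeight s a) := by
  unfold hsaWeight
  exact Measurable.ite (measurableSet_le (by fun_prop) measurable_const) (by fun_prop)
    (by fun_prop)

theorem eLpNorm_hsaWeight_mul_box_le {s a c p q W : ℝ} (hc : 0 ≤ c) (hpq : p ≤ q) (hW : 0 ≤ W)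
    (h : ∀ ξ ∈ Icc p q, hsaWeight s a (2 * Real.pi * ξ) ≤ W) :
    eLpNorm (fun ξ => (hsaWeight s a (2 * Real.pi * ξ) : ℂ) * (box c p q ξ : ℂ)) 2 volume ≤
      ENNReal.ofReal (W * c * √(q - p)) := by
  rw [← eLpNorm_box (mul_nonneg hW hc) hpq]
  refine eLpNorm_mono fun ξ => ?_
  rw [norm_mul, Complex.norm_real, Complex.norm_real, Real.norm_of_nonneg (hsaWeight_nonneg _ _ _),
    Real.norm_of_nonneg (box_nonneg hc ξ), Real.norm_of_nonneg (box_nonneg (mul_nonneg hW hc) ξ)]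
  by_cases hξ : ξ ∈ Icc p q
  · rw [box_of_mem hξ, box_of_mem hξ]
    exact mul_le_mul_of_nonneg_right (h ξ hξ) hc
  · rw [box_of_notMem hξ, box_of_notMem hξ, mul_zero]

theorem le_eLpNorm_of_forall_le {G : ℝ → ℂ} {p q B : ℝ} (hpq : p ≤ q) (hB : 0 ≤ B)
    (h : ∀ ξ ∈ Icc p q, B ≤ ‖G ξ‖) : ENNReal.ofReal (B * √(q - p)) ≤ eLpNorm G 2 volume := by
  rw [← eLpNorm_box hB hpq]
  refine eLpNorm_mono fun ξ => ?_
  rw [Real.norm_of_nonneg (box_nonneg hB ξ)]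
  by_cases hξ : ξ ∈ Icc p q
  · rw [box_of_mem hξ]; exact h ξ hξ
  · rw [box_of_notMem hξ]; exact norm_nonneg _

/-- Cauchy–Schwarz on an interval of length at most `1`. It allows an error term that is controlled
only in `L¹`. -/
theorem le_eLpNorm_of_le_setIntegral {G : ℝ → ℂ} {φ : ℝ → ℝ} {p q b : ℝ} (hG : Measurable G)
    (hφ : IntegrableOn φ (Icc p q)) (hφG : ∀ ξ ∈ Icc p q, φ ξ ≤ ‖G ξ‖) (hpq : q - p ≤ 1)
    (h : b ≤ ∫ ξ in Icc p q, φ ξ) : ENNReal.ofReal b ≤ eLpNorm G 2 volume := by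
  by_cases htop : eLpNorm G 2 volume = ∞
  · rw [htop]; exact le_top
  have hGi : IntegrableOn G (Icc p q) :=
    ((show MemLp G 2 volume from ⟨hG.aestronglyMeasurable, lt_top_iff_ne_top.2 htop⟩).restrict
      (Icc p q)).integrable (by norm_num)
  calc ENNReal.ofReal b ≤ ENNReal.ofReal (∫ ξ in Icc p q, ‖G ξ‖) :=
        ENNReal.ofReal_le_ofReal (h.trans (setIntegral_mono_on hφ hGi.norm measurableSet_Icc hφG))
    _ = eLpNorm G 1 (volume.restrict (Icc p q)) := by
        rw [eLpNorm_one_eq_lintegral_enorm, ← ofReal_integral_norm_eq_lintegral_enorm hGi]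
    _ ≤ eLpNorm G 2 (volume.restrict (Icc p q)) * 1 := by
        refine (eLpNorm_le_eLpNorm_mul_rpow_measure_univ (p := 1) (q := 2) (by norm_num)
          hG.aestronglyMeasurable).trans ?_
        gcongr
        refine ENNReal.rpow_le_one ?_ (by norm_num)
        rw [Measure.restrict_apply_univ, Real.volume_Icc]
        exact ENNReal.ofReal_le_one.2 hpq
    _ ≤ eLpNorm G 2 volume := by
        rw [mul_one]
        exact eLpNorm_mono_measure _ Measure.restrict_le_self

/-! ### Instability for `a > 1/2`: low frequencies acting on a fixed box -/

/-- Some `L²` solution on `[0, T]`, with data of norm less than `R`, at which the solution operator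
is discontinuous. -/
def HasUnstableSolution (s a T : ℝ) (R : ℝ≥0∞) : Prop :=
  ∃ (v₀ : L2) (v : ℝ → L2), IsL2Solution T v₀ v ∧ hsaNorm s a v₀ < R ∧
    ∃ ε : ℝ≥0∞, 0 < ε ∧ ∀ δ : ℝ≥0∞, 0 < δ → ∃ (u₀ : L2) (u : ℝ → L2), IsL2Solution T u₀ u ∧
      hsaNorm s a u₀ < R ∧ hsaNorm s a ((u₀ : 𝓢'(ℝ, ℂ)) - (v₀ : 𝓢'(ℝ, ℂ))) < δ ∧
      ∃ t ∈ Icc 0 T, ε < hsaNorm s a ((u t : 𝓢'(ℝ, ℂ)) - (v t : 𝓢'(ℝ, ℂ)))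

theorem memLp_two_of_integrable_of_bound {f : ℝ → ℂ} {S : ℝ} (hf : Integrable f)
    (hS : ∀ ξ, ‖f ξ‖ ≤ S) : MemLp f 2 volume := by
  rw [memLp_two_iff_integrable_sq_norm hf.aestronglyMeasurable]
  refine (hf.norm.bdd_mul (c := S) hf.aestronglyMeasurable.norm (.of_forall fun ξ => ?_)).congr
    (.of_forall fun ξ => (sq _).symm)
  rw [norm_norm]
  exact hS ξ

/-- The bound `33/10` covers `|ξ (ξ - η)| ≤ (7/4)(7/4 + 1/8)`, the worst case among the two
constructions. -/
theorem phase_le_one {t x : ℝ} (ht : t ≤ 1 / 280) (ht0 : 0 ≤ t) (hx : |x| ≤ 33 / 10) :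
    8 * Real.pi ^ 2 * t * |x| ≤ 1 := by
  have hpi : Real.pi ^ 2 ≤ 10 := by nlinarith [Real.pi_lt_d2, Real.pi_pos]
  calc 8 * Real.pi ^ 2 * t * |x| ≤ 8 * 10 * (1 / 280) * (33 / 10) := by gcongr
    _ ≤ 1 := by norm_num

theorem hsaWeight_of_one_lt {s a x : ℝ} (hx : 1 < x) : hsaWeight s a x = x ^ s := by
  rw [hsaWeight, abs_of_pos (by linarith), if_neg (not_le.2 hx)]

theorem hsaWeight_of_le_one {s a x : ℝ} (h0 : 0 ≤ x) (hx : x ≤ 1) : hsaWeight s a x = x ^ a := by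
  rw [hsaWeight, abs_of_nonneg h0, if_pos hx]

/-- At frequencies in `[-7/4, -5/4]` the autocorrelation of two boxes comes only from their mutual
interaction. -/
theorem twoBoxes_mul_shift {c e d ξ : ℝ} (hd : d ≤ 1 / 8) (hξ : ξ ∈ Icc (-(7 / 4) : ℝ) (-(5 / 4)))
    (η : ℝ) : (box c 1 2 η + box e 0 d η) * (box c 1 2 (η - ξ) + box e 0 d (η - ξ)) =
      box (e * c) 0 d η := by
  obtain ⟨h1, h2⟩ := hξ
  by_cases hη : η ∈ Icc 0 d
  · have hη' := hη
    obtain ⟨h3, h4⟩ := hη'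
    rw [box_of_mem hη, box_of_mem hη, box_of_notMem (c := c) (p := 1) (ξ := η)
      (fun h => by linarith [h.1]), box_of_mem (c := c) (ξ := η - ξ) ⟨by linarith, by linarith⟩,
      box_of_notMem (ξ := η - ξ) (fun h => by linarith [h.2])]
    ring
  · rw [box_of_notMem hη, box_of_notMem hη]
    by_cases hη2 : η ∈ Icc (1 : ℝ) 2
    · rw [box_of_notMem (ξ := η - ξ) (fun h => by linarith [h.2, hη2.1]),
        box_of_notMem (ξ := η - ξ) (fun h => by linarith [h.2, hη2.1])]
      ring
    · rw [box_of_notMem hη2]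
      ring

/-- Weight `d^a`, height `c/d` and root width `d^(1/2)` multiply to `d^(a - 1/2)`; this is where `a
> 1/2` is needed. -/
theorem eventually_lowFrequency_small {a : ℝ} (ha : 1 / 2 < a) (c : ℝ) {δ : ℝ≥0∞} (hδ : 0 < δ) :
    ∀ᶠ d in 𝓝[>] (0 : ℝ), ENNReal.ofReal ((2 * Real.pi * d) ^ a * (c / d) * √(d - 0)) < δ := by
  have h1 : Tendsto (fun d : ℝ => (2 * Real.pi) ^ a * c * d ^ (a - 1 / 2)) (𝓝[>] 0) (𝓝 0) := by
    have h2 := (Real.continuousAt_rpow_const 0 (a - 1 / 2) (Or.inr (by linarith))).tendsto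
    rw [Real.zero_rpow (by linarith)] at h2
    have h3 := Tendsto.const_mul ((2 * Real.pi) ^ a * c) (f := fun d : ℝ => d ^ (a - 1 / 2))
      (h2.mono_left (nhdsWithin_le_nhds (s := Ioi 0)))
    rwa [mul_zero] at h3
  have h4 := ENNReal.tendsto_ofReal h1
  rw [ENNReal.ofReal_zero] at h4
  filter_upwards [h4.eventually_lt_const hδ, self_mem_nhdsWithin] with d hd hd0
  have hd0 : 0 < d := hd0
  convert hd using 2
  rw [sub_zero, Real.mul_rpow (by positivity) hd0.le, Real.sqrt_eq_rpow,
    show a - 1 / 2 = a + -1 + 1 / 2 by ring, Real.rpow_add hd0, Real.rpow_add hd0,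
    Real.rpow_neg_one]
  ring

theorem hasUnstableSolution_of_half_lt {s a T : ℝ} {R : ℝ≥0∞} (ha : 1 / 2 < a) (hs : s ≤ 0)
    (hT : 0 < T) (hR : 0 < R) : HasUnstableSolution s a T R := by
  obtain ⟨ρ, -, hρ0, hρR⟩ := ENNReal.lt_iff_exists_real_btwn.1 hR
  have hρ : 0 < ρ := ENNReal.ofReal_pos.1 hρ0
  -- Large enough for both `8T ≤ A` and `4096 t ≤ A`, the latter making the Duhamel remainder at
  -- most half of the main term.
  set A : ℝ := 5000 * (T + 1) with hA
  have hA0 : 0 < A := by positivity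
  set c : ℝ := min (ρ / 2) (1 / (8 * A)) with hc
  have hc0 : 0 < c := by positivity
  have hcρ : c ≤ ρ / 2 := min_le_left _ _
  have hcA : 4 * A * (2 * c) ≤ 1 := by
    have : c ≤ 1 / (8 * A) := min_le_right _ _
    rw [le_div_iff₀ (by positivity)] at this
    linarith
  set t : ℝ := min T (1 / 280) with ht
  have ht0 : 0 < t := by positivity
  have htT : t ∈ Icc 0 T := ⟨ht0.le, min_le_left _ _⟩
  have ht1 : t ≤ 1 / 280 := min_le_right _ _
  have hgm : Measurable fun η => (box c 1 2 η : ℂ) := by fun_prop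
  have hgi : Integrable fun η => (box c 1 2 η : ℂ) := integrable_box.ofReal
  have hgn (η : ℝ) : ‖(box c 1 2 η : ℂ)‖ = box c 1 2 η := by
    rw [Complex.norm_real, Real.norm_of_nonneg (box_nonneg hc0.le η)]
  have hgS (η : ℝ) : ‖(box c 1 2 η : ℂ)‖ ≤ c := by rw [hgn]; exact box_le hc0.le η
  have hgl : ∫ η, ‖(box c 1 2 η : ℂ)‖ ≤ 2 * c := by
    simp_rw [hgn]
    rw [integral_box (by norm_num)]
    linarith
  obtain ⟨Mg, G, hMg, hG⟩ :=
    exists_isMajorant_isProfile (T := T) hgm hgi hT.le (by linarith) hgl hcA hgS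
  have hgL := memLp_two_of_integrable_of_bound hgi hgS
  have hgnorm : eLpNorm (fun ξ => (hsaWeight s a (2 * Real.pi * ξ) : ℂ) * (box c 1 2 ξ : ℂ)) 2
      volume ≤ ENNReal.ofReal (ρ / 2) := by
    refine (eLpNorm_hsaWeight_mul_box_le hc0.le (by norm_num) zero_le_one fun ξ hξ => ?_).trans
      (ENNReal.ofReal_le_ofReal ?_)
    · have : 1 < 2 * Real.pi * ξ := by nlinarith [Real.pi_gt_three, hξ.1]
      rw [hsaWeight_of_one_lt this]
      exact Real.rpow_le_one_of_one_le_of_nonpos this.le hs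
    · norm_num
      linarith
  refine ⟨invFourier _ hgL, _, hG.isL2Solution hMg hT.le hgL, ?_,
    ENNReal.ofReal (11 ^ s * (t * c ^ 2 / 16)), ENNReal.ofReal_pos.2 (by positivity),
    fun δ hδ => ?_⟩
  · rw [hsaNorm_invFourier]
    exact (hgnorm.trans (ENNReal.ofReal_le_ofReal (by linarith))).trans_lt hρR
  have hmin : 0 < min δ (ENNReal.ofReal (ρ / 2)) :=
    lt_min hδ (ENNReal.ofReal_pos.2 (by positivity))
  -- The width `d` is chosen last: the mass `c` of the added box, and hence `A`, `t` and the output,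
  -- do not depend on it.
  obtain ⟨d, hdsmall, hd0, hd8⟩ := ((eventually_lowFrequency_small ha c hmin).and
    (Ioc_mem_nhdsGT (show (0 : ℝ) < 1 / 8 by norm_num))).exists
  have he0 : 0 ≤ c / d := by positivity
  set f : ℝ → ℝ := fun η => box c 1 2 η + box (c / d) 0 d η with hf
  have hf0 (η : ℝ) : 0 ≤ f η := add_nonneg (box_nonneg hc0.le _) (box_nonneg he0 _)
  have hfm' : Measurable f := by fun_prop
  have hfm : Measurable fun η => (f η : ℂ) := by fun_prop
  have hfi' : Integrable f := integrable_box.add integrable_box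
  have hfi : Integrable fun η => (f η : ℂ) := hfi'.ofReal
  have hfn (η : ℝ) : ‖(f η : ℂ)‖ = f η := by
    rw [Complex.norm_real, Real.norm_of_nonneg (hf0 η)]
  have hfS (η : ℝ) : ‖(f η : ℂ)‖ ≤ c + c / d := by
    rw [hfn]
    exact add_le_add (box_le hc0.le _) (box_le he0 _)
  have hfl : ∫ η, ‖(f η : ℂ)‖ ≤ 2 * c := by
    simp_rw [hfn]
    rw [integral_add integrable_box integrable_box, integral_box (by norm_num),
      integral_box hd0.le, sub_zero, div_mul_cancel₀ _ hd0.ne']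
    linarith
  obtain ⟨Mf, F, hMf, hF⟩ :=
    exists_isMajorant_isProfile (T := T) hfm hfi hT.le (by linarith) hfl hcA hfS
  have hfL := memLp_two_of_integrable_of_bound hfi hfS
  have hhnorm : eLpNorm (fun ξ => (hsaWeight s a (2 * Real.pi * ξ) : ℂ) * (box (c / d) 0 d ξ : ℂ))
      2 volume < min δ (ENNReal.ofReal (ρ / 2)) := by
    refine (eLpNorm_hsaWeight_mul_box_le he0 hd0.le (W := (2 * Real.pi * d) ^ a)
      (by positivity) fun ξ hξ => ?_).trans_lt hdsmall
    have h0 : 0 ≤ 2 * Real.pi * ξ := mul_nonneg (by positivity) hξ.1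
    have h1 : 2 * Real.pi * ξ ≤ 2 * Real.pi * d :=
      mul_le_mul_of_nonneg_left hξ.2 (by positivity)
    rw [hsaWeight_of_le_one h0 (by nlinarith [Real.pi_lt_d2])]
    exact Real.rpow_le_rpow h0 h1 (by linarith)
  refine ⟨invFourier _ hfL, _, hF.isL2Solution hMf hT.le hfL, ?_, ?_, t, htT, ?_⟩
  · rw [hsaNorm_invFourier]
    have hadd : (fun ξ => (hsaWeight s a (2 * Real.pi * ξ) : ℂ) * (f ξ : ℂ)) =
        (fun ξ => (hsaWeight s a (2 * Real.pi * ξ) : ℂ) * (box c 1 2 ξ : ℂ)) +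
          fun ξ => (hsaWeight s a (2 * Real.pi * ξ) : ℂ) * (box (c / d) 0 d ξ : ℂ) := by
      funext ξ
      simp only [hf, Pi.add_apply]
      push_cast
      ring
    have hw : Measurable fun ξ : ℝ => (hsaWeight s a (2 * Real.pi * ξ) : ℂ) :=
      Complex.measurable_ofReal.comp ((measurable_hsaWeight s a).comp (by fun_prop))
    rw [hadd]
    calc _ ≤ ENNReal.ofReal (ρ / 2) + ENNReal.ofReal (ρ / 2) := by
          refine (eLpNorm_add_le (hw.mul hgm).aestronglyMeasurable
            (hw.mul (by fun_prop)).aestronglyMeasurable (by norm_num)).trans ?_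
          exact add_le_add hgnorm (hhnorm.le.trans (min_le_right _ _))
      _ = ENNReal.ofReal ρ := by
          rw [← ENNReal.ofReal_add (by positivity) (by positivity), add_halves]
      _ < R := hρR
  · rw [hsaNorm_invFourier_sub]
    refine lt_of_eq_of_lt ?_ (hhnorm.trans_le (min_le_left _ _))
    congr 1
    funext ξ
    simp only [hf]
    push_cast
    ring
  · rw [hsaNorm_invFourier_sub]
    have hlow : ∀ ξ ∈ Icc (-(7 / 4) : ℝ) (-(5 / 4)),
        t * (c ^ 2 / 2) - 16 * t ^ 2 / A * (autocorr Mf ξ + autocorr Mg ξ) ≤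
          ‖wave F t ξ - wave G t ξ‖ := by
      intro ξ hξ
      obtain ⟨hξ1, hξ2⟩ := id hξ
      have hfξ : f ξ = 0 := by
        simp only [hf]
        rw [box_of_notMem (fun h => by linarith [h.1]), box_of_notMem (fun h => by linarith [h.1]),
          add_zero]
      have hcorr : autocorr f ξ = c ^ 2 := by
        simp only [autocorr, hf]
        simp_rw [twoBoxes_mul_shift hd8 hξ]
        rw [integral_box hd0.le]
        field_simp
        ring
      have h1 := hF.le_norm_of_phase_le hMf hfm' hA0 hf0 htT hfξ fun η hη => by
        have hη : η ∈ Icc 0 d := by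
          by_contra hcon
          refine hη ?_
          rw [show f η * f (η - ξ) = _ from twoBoxes_mul_shift hd8 hξ η, box_of_notMem hcon]
        refine phase_le_one ht1 ht0.le ?_
        rw [abs_le]
        constructor <;> nlinarith [hη.1, hη.2]
      -- A shift by at least `5/4` separates `[1, 2]` from itself, so the reference solution has no
      -- first-order output at these frequencies.
      have h2 := hG.norm_le_of_mul_eq_zero hMg (by fun_prop) hA0 htT (ξ := ξ)
        (box_of_notMem fun h => by linarith [h.1]) fun η => by
          by_cases hη : η ∈ Icc (1 : ℝ) 2
          · rw [box_of_notMem (ξ := η - ξ) (fun h => by linarith [h.2, hη.1]), mul_zero]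
          · rw [box_of_notMem hη, zero_mul]
      have h3 : ‖wave F t ξ - wave G t ξ‖ = ‖F t ξ - G t ξ‖ := by
        rw [wave, wave, ← mul_sub, norm_mul, norm_schr, one_mul]
      rw [hcorr] at h1
      rw [h3]
      linarith [norm_sub_norm_le (F t ξ) (G t ξ)]
    have hcf := hMf.integrable_autocorr
    have hcg := hMg.integrable_autocorr
    have hφ : IntegrableOn (fun ξ => 11 ^ s * (t * (c ^ 2 / 2) - 16 * t ^ 2 / A *
        (autocorr Mf ξ + autocorr Mg ξ))) (Icc (-(7 / 4) : ℝ) (-(5 / 4))) :=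
      ((integrableOn_const (by simp)).sub
        ((hcf.integrableOn.add hcg.integrableOn).const_mul _)).const_mul _
    have hw : Measurable fun ξ : ℝ => (hsaWeight s a (2 * Real.pi * ξ) : ℂ) :=
      Complex.measurable_ofReal.comp ((measurable_hsaWeight s a).comp (by fun_prop))
    refine lt_of_lt_of_le ?_ (le_eLpNorm_of_le_setIntegral
      (hw.mul ((hF.measurable_wave t).sub (hG.measurable_wave t))) hφ (fun ξ hξ => ?_) (by norm_num)
      (b := 11 ^ s * (t * c ^ 2 / 8)) ?_)
    · refine (ENNReal.ofReal_lt_ofReal_iff (by positivity)).2 ?_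
      have : 0 < (11 : ℝ) ^ s * (t * c ^ 2) := by positivity
      linarith
    · rw [norm_mul, Complex.norm_real, Real.norm_of_nonneg (hsaWeight_nonneg _ _ _)]
      have habs : |2 * Real.pi * ξ| = 2 * Real.pi * (-ξ) := by
        rw [abs_of_nonpos (by nlinarith [Real.pi_pos, hξ.2])]; ring
      have hgt : 1 < |2 * Real.pi * ξ| := by rw [habs]; nlinarith [Real.pi_gt_three, hξ.2]
      -- `2π · 7/4` is just below `11`.
      have hle : |2 * Real.pi * ξ| ≤ 11 := by
        rw [habs]; nlinarith [Real.pi_lt_d4, Real.pi_pos, hξ.1, hξ.2]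
      have hwt : 11 ^ s ≤ hsaWeight s a (2 * Real.pi * ξ) := by
        rw [hsaWeight, if_neg (not_le.2 hgt)]
        exact Real.rpow_le_rpow_of_nonpos (by linarith) hle hs
      calc _ ≤ 11 ^ s * ‖wave F t ξ - wave G t ξ‖ :=
            mul_le_mul_of_nonneg_left (hlow ξ hξ) (by positivity)
        _ ≤ _ := mul_le_mul_of_nonneg_right hwt (norm_nonneg _)
    · have hsum : IntegrableOn (fun ξ => 16 * t ^ 2 / A * (autocorr Mf ξ + autocorr Mg ξ))
          (Icc (-(7 / 4) : ℝ) (-(5 / 4))) :=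
        (hcf.integrableOn.add hcg.integrableOn).const_mul _
      rw [integral_const_mul]
      refine mul_le_mul_of_nonneg_left ?_ (by positivity)
      rw [integral_sub (integrable_const _) hsum, setIntegral_const, integral_const_mul,
        integral_add hcf.integrableOn hcg.integrableOn, Real.volume_real_Icc_of_le (by norm_num),
        smul_eq_mul]
      have h1 := setIntegral_le_integral (s := Icc (-(7 / 4) : ℝ) (-(5 / 4))) hcf
        (.of_forall hMf.autocorr_nonneg)
      have h2 := setIntegral_le_integral (s := Icc (-(7 / 4) : ℝ) (-(5 / 4))) hcg
        (.of_forall hMg.autocorr_nonneg)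
      have h3 := hMf.integral_autocorr_le
      have h4 := hMg.integral_autocorr_le
      -- The heights blow up as `d → 0`, so the remainder is bounded by mass: each autocorrelation
      -- has integral at most `4 (2c)² = 16c²`.
      have h5 : 16 * t ^ 2 / A * ((∫ ξ in Icc (-(7 / 4) : ℝ) (-(5 / 4)), autocorr Mf ξ) +
          ∫ ξ in Icc (-(7 / 4) : ℝ) (-(5 / 4)), autocorr Mg ξ) ≤
          16 * t ^ 2 / A * (32 * c ^ 2) := by
        refine mul_le_mul_of_nonneg_left ?_ (by positivity)
        nlinarith
      have h6 : 16 * t ^ 2 / A * (32 * c ^ 2) ≤ t * c ^ 2 / 8 := by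
        rw [div_mul_eq_mul_div, div_le_iff₀ hA0]
        have : 4096 * t ≤ A := by linarith
        nlinarith [mul_pos ht0 (pow_pos hc0 2)]
      linarith

/-! ### Instability for `a ≤ 1/2`: high frequencies feeding low ones -/

theorem box_mul_shift {c p q ξ : ℝ} (hξ : 0 ≤ ξ) (η : ℝ) :
    box c p q η * box c p q (η - ξ) = box (c * c) (p + ξ) q η := by
  by_cases hη : η ∈ Icc (p + ξ) q
  · rw [box_of_mem hη, box_of_mem ⟨by linarith [hη.1], hη.2⟩,
      box_of_mem ⟨by linarith [hη.1], by linarith [hη.2]⟩]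
  · rw [box_of_notMem hη]
    by_cases h1 : η ∈ Icc p q
    · rw [box_of_notMem (ξ := η - ξ) (fun h => hη ⟨by linarith [h.1], h1.2⟩), mul_zero]
    · rw [box_of_notMem h1, zero_mul]

theorem hasUnstableSolution_of_le_half {s a T : ℝ} {R : ℝ≥0∞} (hs : s < -1 / 4 - a / 2)
    (ha0 : 0 ≤ a) (ha : a ≤ 1 / 2) (hT : 0 < T) (hR : 0 < R) : HasUnstableSolution s a T R := by
  set A : ℝ := 5000 * (T + 1) with hA
  have hA0 : 0 < A := by positivity
  set c : ℝ := 1 / (4 * A) with hc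
  have hc0 : 0 < c := by positivity
  have hcA : 4 * A * c ≤ 1 := by rw [hc]; field_simp; rfl
  set t : ℝ := min T (1 / 280) with ht
  have ht0 : 0 < t := by positivity
  have htT : t ∈ Icc 0 T := ⟨ht0.le, min_le_left _ _⟩
  have ht1 : t ≤ 1 / 280 := min_le_right _ _
  have hzero : MemLp (fun _ : ℝ => (0 : ℂ)) 2 volume := MemLp.zero'
  refine ⟨invFourier _ hzero, _, (IsProfile.zero T).isL2Solution (IsMajorant.zero A) hT.le hzero, ?_,
    ENNReal.ofReal (t * c ^ 2 / 32), ENNReal.ofReal_pos.2 (by positivity), fun δ hδ => ?_⟩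
  · rw [hsaNorm_invFourier]
    simpa using hR
  -- The height `N^r` is tuned so that the output, `N^(-a) · N^r · N^(-1/2)` up to constants,
  -- neither decays nor grows. The data then have norm at most `c N^(s + r/2)`, which tends to `0`
  -- exactly when `s < -1/4 - a/2`.
  obtain ⟨r, hr⟩ : ∃ r : ℝ, r = a + 1 / 2 := ⟨_, rfl⟩
  have hsmall : ∀ᶠ N : ℝ in atTop, ENNReal.ofReal (c * N ^ (s + r / 2)) < min δ R := by
    have h1 : Tendsto (fun N : ℝ => c * N ^ (-(-(s + r / 2)))) atTop (𝓝 (c * 0)) :=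
      (tendsto_rpow_neg_atTop (by rw [hr]; linarith)).const_mul c
    have h2 := ENNReal.tendsto_ofReal h1
    rw [mul_zero, ENNReal.ofReal_zero] at h2
    simp only [neg_neg] at h2
    exact h2.eventually_lt_const (lt_min hδ hR)
  obtain ⟨N, hNsmall, hN4⟩ := (hsmall.and (eventually_ge_atTop 4)).exists
  have hN0 : 0 < N := by linarith
  have hN1 : 1 ≤ N := by linarith
  set H : ℝ := N ^ r with hH
  set w : ℝ := N ^ (-r) with hw
  have hH0 : 0 < H := by positivity
  have hw0 : 0 < w := by positivity
  have hHw : H * w = 1 := by rw [hH, hw, ← Real.rpow_add hN0, add_neg_cancel, Real.rpow_zero]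
  have hw1 : w ≤ 1 := Real.rpow_le_one_of_one_le_of_nonpos hN1 (by rw [hr]; linarith)
  have hwN : 1 / N ≤ w := by
    rw [one_div, ← Real.rpow_neg_one]
    exact Real.rpow_le_rpow_of_exponent_le hN1 (by rw [hr]; linarith)
  have hcH : 0 ≤ c * H := by positivity
  have hpq : N ≤ N + w := by linarith
  set f : ℝ → ℝ := box (c * H) N (N + w) with hf
  have hf0 (η : ℝ) : 0 ≤ f η := box_nonneg hcH η
  have hfm' : Measurable f := measurable_box
  have hfm : Measurable fun η => (f η : ℂ) := by fun_prop
  have hfi : Integrable fun η => (f η : ℂ) := integrable_box.ofReal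
  have hfn (η : ℝ) : ‖(f η : ℂ)‖ = f η := by
    rw [Complex.norm_real, Real.norm_of_nonneg (hf0 η)]
  have hfS (η : ℝ) : ‖(f η : ℂ)‖ ≤ c * H := by rw [hfn]; exact box_le hcH η
  have hfl : ∫ η, ‖(f η : ℂ)‖ ≤ c := by
    simp_rw [hfn]
    rw [hf, integral_box hpq, add_sub_cancel_left, mul_assoc, hHw, mul_one]
  obtain ⟨M, F, hM, hF⟩ :=
    exists_isMajorant_isProfile (T := T) hfm hfi hT.le (by linarith) hfl hcA hfS
  have hfL := memLp_two_of_integrable_of_bound hfi hfS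
  have hfnorm : eLpNorm (fun ξ => (hsaWeight s a (2 * Real.pi * ξ) : ℂ) * (f ξ : ℂ)) 2 volume <
      min δ R := by
    refine (eLpNorm_hsaWeight_mul_box_le hcH hpq (W := N ^ s) (by positivity)
      fun ξ hξ => ?_).trans_lt (lt_of_eq_of_lt ?_ hNsmall)
    · have h1 : N ≤ 2 * Real.pi * ξ := by nlinarith [Real.pi_gt_three, hξ.1]
      rw [hsaWeight_of_one_lt (by linarith)]
      exact Real.rpow_le_rpow_of_nonpos hN0 h1 (by linarith)
    · congr 1
      rw [add_sub_cancel_left, hw, Real.sqrt_eq_rpow, ← Real.rpow_mul hN0.le, hH,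
        show s + r / 2 = s + r + -r * (1 / 2) by ring, Real.rpow_add hN0, Real.rpow_add hN0]
      ring
  refine ⟨invFourier _ hfL, _, hF.isL2Solution hM hT.le hfL, ?_, ?_, t, htT, ?_⟩
  · rw [hsaNorm_invFourier]
    exact hfnorm.trans_le (min_le_right _ _)
  · rw [hsaNorm_invFourier_sub]
    simp only [sub_zero]
    exact hfnorm.trans_le (min_le_left _ _)
  · rw [hsaNorm_invFourier_sub]
    have hwave (ξ : ℝ) : wave (fun _ _ => 0) t ξ = 0 := mul_zero _
    simp only [hwave, sub_zero]
    have hlow : ∀ ξ ∈ Icc (1 / (4 * N)) (1 / (2 * N)),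
        N ^ (-a) * (t * c ^ 2 * H / 8) ≤
          ‖(hsaWeight s a (2 * Real.pi * ξ) : ℂ) * wave F t ξ‖ := by
      intro ξ hξ
      have hξ1 : 1 / 4 ≤ N * ξ := by
        have := hξ.1
        rw [div_le_iff₀ (by positivity)] at this
        linarith
      have hξ2 : N * ξ ≤ 1 / 2 := by
        have := hξ.2
        rw [le_div_iff₀ (by positivity)] at this
        linarith
      have hξ0 : 0 ≤ ξ := le_trans (by positivity) hξ.1
      have hξ8 : ξ ≤ 1 / 8 := by nlinarith only [hξ2, hN4, hξ0]
      -- Here `a ≤ 1/2` enters: `r ≤ 1` keeps the box at least `1/N` wide, so a shift by `ξ ≤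
      -- 1/(2N)` retains half of the overlap.
      have hξw : ξ ≤ w / 2 := by
        refine hξ.2.trans ?_
        rw [show 1 / (2 * N) = 1 / N / 2 by field_simp]
        linarith
      have hfξ : f ξ = 0 := box_of_notMem fun h => by linarith [h.1]
      have hcorr : autocorr f ξ = (c * H) ^ 2 * (w - ξ) := by
        simp only [autocorr, hf]
        simp_rw [box_mul_shift hξ0]
        rw [integral_box (by linarith)]
        ring
      have h1 := hF.le_norm_of_phase_le hM hfm' hA0 hf0 htT hfξ fun η hη => by
        have hη : η ∈ Icc (N + ξ) (N + w) := by
          by_contra hcon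
          refine hη ?_
          rw [hf, box_mul_shift hξ0, box_of_notMem hcon]
        -- Although `η` is of size `N`, the phase stays bounded since `ξ (η - ξ) ≤ Nξ + wξ` and `Nξ
        -- ≤ 1/2`.
        refine phase_le_one ht1 ht0.le ?_
        rw [abs_mul, abs_of_nonneg hξ0, abs_sub_comm, abs_of_nonneg (by linarith [hη.1])]
        nlinarith only [hη.1, hη.2, hξ2, hξ8, hξ0, hw1]
      have h2 : t * c ^ 2 * H / 4 ≤ t * (autocorr f ξ / 2) := by
        have : c ^ 2 * H / 4 ≤ autocorr f ξ / 2 := by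
          rw [hcorr]
          calc c ^ 2 * H / 4 = c ^ 2 * H * (H * w) / 4 := by rw [hHw, mul_one]
            _ = (c * H) ^ 2 * (w / 2) / 2 := by ring
            _ ≤ (c * H) ^ 2 * (w - ξ) / 2 := by
              have : w / 2 ≤ w - ξ := by linarith
              gcongr
        calc t * c ^ 2 * H / 4 = t * (c ^ 2 * H / 4) := by ring
          _ ≤ _ := mul_le_mul_of_nonneg_left this ht0.le
      -- A sup bound suffices here: mass `c` times height `cH` scales in `N` exactly like the main
      -- term.
      have h3 : 16 * t ^ 2 / A * autocorr M ξ ≤ t * c ^ 2 * H / 8 := by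
        calc 16 * t ^ 2 / A * autocorr M ξ ≤ 16 * t ^ 2 / A * (4 * c * (c * H)) :=
              mul_le_mul_of_nonneg_left (hM.autocorr_le ξ) (by positivity)
          _ ≤ t * c ^ 2 * H / 8 := by
            rw [div_mul_eq_mul_div, div_le_iff₀ hA0]
            have h4 : 64 * t ≤ A / 8 := by linarith
            have h5 : 0 ≤ t * c ^ 2 * H := by positivity
            calc 16 * t ^ 2 * (4 * c * (c * H)) = t * c ^ 2 * H * (64 * t) := by ring
              _ ≤ t * c ^ 2 * H * (A / 8) := mul_le_mul_of_nonneg_left h4 h5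
              _ = t * c ^ 2 * H / 8 * A := by ring
      have hwt : N ^ (-a) ≤ hsaWeight s a (2 * Real.pi * ξ) := by
        rw [hsaWeight_of_le_one (by positivity)
          (by nlinarith only [Real.pi_lt_d2, hξ8, hξ0, Real.pi_pos]),
          Real.rpow_neg hN0.le, ← Real.inv_rpow hN0.le]
        refine Real.rpow_le_rpow (by positivity) ?_ ha0
        rw [inv_le_iff_one_le_mul₀ hN0]
        nlinarith only [Real.pi_gt_three, hξ1]
      rw [norm_mul, Complex.norm_real, Real.norm_of_nonneg (hsaWeight_nonneg _ _ _), norm_wave]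
      exact mul_le_mul hwt (by linarith) (by positivity) (hsaWeight_nonneg _ _ _)
    have hle : 1 / (4 * N) ≤ 1 / (2 * N) := by
      gcongr
      norm_num
    refine lt_of_lt_of_le ?_ (le_eLpNorm_of_forall_le hle (by positivity) hlow)
    have hsqrt : √(1 / (2 * N) - 1 / (4 * N)) = N ^ (-(1 / 2) : ℝ) / 2 := by
      rw [show 1 / (2 * N) - 1 / (4 * N) = N⁻¹ / 2 ^ 2 by field_simp; norm_num,
        Real.sqrt_div (by positivity), Real.sqrt_sq (by norm_num), Real.sqrt_eq_rpow,
        Real.inv_rpow hN0.le, Real.rpow_neg hN0.le]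
    have hprod : N ^ (-a) * H * N ^ (-(1 / 2) : ℝ) = 1 := by
      rw [hH, ← Real.rpow_add hN0, ← Real.rpow_add hN0, hr,
        show -a + (a + 1 / 2) + -(1 / 2) = 0 by ring, Real.rpow_zero]
    rw [hsqrt, show N ^ (-a) * (t * c ^ 2 * H / 8) * (N ^ (-(1 / 2) : ℝ) / 2) =
      t * c ^ 2 / 16 * (N ^ (-a) * H * N ^ (-(1 / 2) : ℝ)) by ring, hprod, mul_one]
    refine (ENNReal.ofReal_lt_ofReal_iff (by positivity)).2 ?_
    have : 0 < t * c ^ 2 := by positivity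
    linarith

/-! ### From instability to ill-posedness -/

theorem hsaNorm_zero (s a : ℝ) : hsaNorm s a 0 = 0 := by
  have hz : ∀ φ : 𝓢(ℝ, ℂ), (𝓕 (0 : 𝓢'(ℝ, ℂ))) φ = ∫ ξ, φ ξ * (fun _ => (0 : ℂ)) ξ := by
    intro φ
    rw [TemperedDistribution.fourier_apply]
    simp
  rw [hsaNorm_eq_eLpNorm (locallyIntegrable_const (0 : ℂ)) hz]
  simp

theorem IsL2Solution.isHsaSolution {s a T : ℝ} {u₀ : L2} {u : ℝ → L2} (h : IsL2Solution T u₀ u) :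
    IsHsaSolution s a T (u₀ : 𝓢'(ℝ, ℂ)) fun t => (u t : 𝓢'(ℝ, ℂ)) := by
  refine ⟨congrArg Lp.toTemperedDistribution h.initial, fun _ => u₀, fun _ => u, fun _ => h, ?_⟩
  simp only [sub_self, hsaNorm_zero, ENNReal.iSup_zero]
  exact tendsto_const_nhds

/-- Well-posedness is tested around `0`. Whatever ball and time it supplies, an unstable solution
lives there, and `L²` solutions count as `H^{s,a}` solutions, so continuous dependence fails at its
datum. -/
theorem not_locallyWellPosed {s a : ℝ}
    (h : ∀ T : ℝ, 0 < T → ∀ R : ℝ≥0∞, 0 < R → HasUnstableSolution s a T R) :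
    ¬ LocallyWellPosed s a := by
  intro hwp
  obtain ⟨r, hr, T, hT, -, -, hcont⟩ := hwp 0 (by rw [hsaNorm_zero]; exact ENNReal.zero_lt_top)
  simp only [sub_zero] at hcont
  obtain ⟨v₀, v, hv, hvr, ε, hε, hunst⟩ := h T hT r hr
  obtain ⟨δ, hδ, hδε⟩ := hcont v₀ hvr _ hv.isHsaSolution ε hε
  obtain ⟨u₀, u, hu, hur, huv, t, ht, hlt⟩ := hunst δ hδ
  exact (hδε u₀ hur huv _ hu.isHsaSolution t ht).not_gt hlt

theorem not_solutionOperatorUniformlyContinuous {s a T : ℝ} {R : ℝ≥0∞}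
    (h : HasUnstableSolution s a T R) : ¬ SolutionOperatorUniformlyContinuous s a T R := by
  intro huc
  obtain ⟨v₀, v, hv, hvR, ε, hε, hunst⟩ := h
  obtain ⟨δ, hδ, hδε⟩ := huc ε hε
  obtain ⟨u₀, u, hu, huR, huv, t, ht, hlt⟩ := hunst δ hδ
  exact (hδε u₀ v₀ u v hu hv huR.le hvR.le huv.le t ht).not_gt hlt

theorem hasUnstableSolution {s a : ℝ} (h : (1 / 2 < a ∧ s ≤ 0) ∨ (s < -1 / 4 - a / 2 ∧ 0 ≤ a))
    (T : ℝ) (hT : 0 < T) (R : ℝ≥0∞) (hR : 0 < R) : HasUnstableSolution s a T R := by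
  -- The two parameter regions overlap. Splitting on `a` sends the overlap to the first
  -- construction, where `s < -1/4 - a/2` already gives `s ≤ 0`.
  rcases lt_or_ge (1 / 2) a with ha | ha
  · refine hasUnstableSolution_of_half_lt ha ?_ hT hR
    rcases h with h | h
    · exact h.2
    · linarith [h.1]
  · rcases h with h | h
    · exact absurd h.1 ha.not_gt
    · exact hasUnstableSolution_of_le_half h.1 h.2 ha hT hR

end

theorem theorem1p3 (s a : ℝ) (h : (1 / 2 < a ∧ s ≤ 0) ∨ (s < -1 / 4 - a / 2 ∧ 0 ≤ a)) :
    ¬ LocallyWellPosed s a ∧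
    ∀ T : ℝ, 0 < T → ∀ R : ℝ≥0∞, 0 < R → ¬ SolutionOperatorUniformlyContinuous s a T R :=
  ⟨not_locallyWellPosed (hasUnstableSolution h), fun T hT R hR =>
    not_solutionOperatorUniformlyContinuous (hasUnstableSolution h T hT R hR)⟩
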